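/- **Setting.** Let $(\mathcal M,m)$ be a smooth Riemannian manifold of dimension $n=s+1$ with Levi-Civita connection $\tilde\nabla$, let $\mathcal S$ be a smooth $s$-manifold, and for $t\in[0,1]$ let $\psi_t:\mathcal S\to\mathcal M$ be smooth embeddings (the moving interface). Greek indices refer to a chart of $\mathcal M$, Latin indices to a chart of $\mathcal S$, and repeated indices are summed. Let $g_{ij}=m_{\alpha\beta}\,\partial_i\psi^\alpha\partial_j\psi^\beta$ be the induced metric, and let $\nabla$ be the Levi-Civita connection of $g$, coupled with $\tilde\nabla$ on Greek indices; $\nabla_i\psi^\alpha=\partial_i\psi^\alpha$. The energy density $\gamma$ is a smooth real function of the inclination, i.e. of unit tangent vectors of $\mathcal M$. It depends on the inclination only and not explicitly on the position: it is invariant under parallel transport (its horizontal derivative vanishes; in Euclidean space, it is a function of the components of the unit normal alone). It is regarded * as a function of the embedding derivatives $\nabla_i\psi^\alpha$, through the unit normal $n$ that they determine; * as a function of the gradient $\tilde\nabla\phi\neq0$ of a level-set function, through $n=\tilde\nabla\phi/|\tilde\nabla\phi|$. The derivatives of $\gamma$ below are derivatives of these functions at a fixed point of $\mathcal M$. Let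 $W\subset\mathbb R\times\mathcal M$ be an open set that contains all points $(t,\psi_t(p))$, $t\in[0,1]$, $p\in\mathcal S$. Let $\phi(t,q)$ be smooth on $W\cap([0,1]\times\mathcal M)$ with $\phi(t,\psi_t(p))=0$, normalised like a signed distance function: $|\tilde\nabla\phi|_m=1$ on $W\cap([0,1]\times\mathcal M)$. Unit normals point to the side of increasing $\phi$. Along the interface, put $$A^\alpha=m^{\alpha\beta}\nabla_i\Big(\frac{\partial\gamma}{\partial\nabla_i\psi^\beta}+\gamma\,g^{iq}m_{\sigma\beta}\nabla_q\psi^\sigma\Big),$$ and define $A$ in the same way along every smoothly immersed piece of a hypersurface $\{\phi(t,\cdot)=c\}$ in place of $\psi_t$. Let $\mu\in\mathbb R$. **Statement.** For every $t\in[0,1]$: 1. At every point of the interface $\psi_t(\mathcal S)$, in all charts, $$A^\alpha\tilde\nabla_\alpha\phi=-\Big(\gamma m^{\alpha\beta}+\frac{\partial^2\gamma}{\partial\tilde\nabla_\beta\phi\,\partial\tilde\nabla_\alpha\phi}\Big)\tilde\nabla_\alpha\tilde\nabla_\beta\phi .$$ Consequently, for $v=\mu A$ there, the level-set transport equation $\frac{\partial\phi}{\partial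 t}+v^\alpha\tilde\nabla_\alpha\phi=0$ holds at that point if and only if $$\frac{\partial\phi}{\partial t}-\mu\Big(\gamma m^{\alpha\beta}+\frac{\partial^2\gamma}{\partial\tilde\nabla_\beta\phi\,\partial\tilde\nabla_\alpha\phi}\Big)\tilde\nabla_\alpha\tilde\nabla_\beta\phi=0$$ holds at that point. 2. The same equivalence holds at every $q$ with $(t,q)\in W$ when the velocity is extended off the interface by $v(q)=\mu A(q)$, where $A(q)$ is computed along a piece of the level hypersurface of $\phi(t,\cdot)$ through $q$. -/

import Mathlib

open Set Filter Topology
open scoped Manifold ContDiff Matrix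

noncomputable section

namespace LevelSetFlow

/-- The coordinate space `ℝⁿ`. -/
abbrev Coord (n : ℕ) : Type := EuclideanSpace ℝ (Fin n)

/-- The `α`-th coordinate vector. -/
def coordVec {n : ℕ} (α : Fin n) : Coord n := EuclideanSpace.single α 1

/-- The partial derivative `∂_α f (z)`. -/
def pderiv {n : ℕ} (f : Coord n → ℝ) (α : Fin n) (z : Coord n) : ℝ :=
  fderiv ℝ f z (coordVec α)

/-! ### Tensor calculus in a chart

`G z` is the matrix of components of a Riemannian metric at the coordinate point `z`. -/

/-- Christoffel symbol `Γ^σ_{αβ}` of the Levi-Civita connection of `G`. -/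
def christoffel {n : ℕ} (G : Coord n → Matrix (Fin n) (Fin n) ℝ) (z : Coord n)
    (σ α β : Fin n) : ℝ :=
  (1 / 2) * ∑ κ, (G z)⁻¹ σ κ *
    (pderiv (fun w => G w κ β) α z + pderiv (fun w => G w κ α) β z
      - pderiv (fun w => G w α β) κ z)

/-- Second covariant derivative `∇_α ∇_β f = ∂_α ∂_β f - Γ^σ_{αβ} ∂_σ f`. -/
def covHessian {n : ℕ} (G : Coord n → Matrix (Fin n) (Fin n) ℝ) (f : Coord n → ℝ)
    (z : Coord n) (α β : Fin n) : ℝ :=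
  pderiv (fun w => pderiv f β w) α z - ∑ σ, christoffel G z σ α β * pderiv f σ z

/-- `m(X, Y) = m_{αβ} X^α Y^β`. -/
def pairing {n : ℕ} (m : Matrix (Fin n) (Fin n) ℝ) (X Y : Coord n) : ℝ :=
  ∑ α, ∑ β, m α β * X α * Y β

/-- `X / √m(X, X)`, the direction of a vector. -/
def direction {n : ℕ} (m : Matrix (Fin n) (Fin n) ℝ) (X : Coord n) : Coord n :=
  (Real.sqrt (pairing m X X))⁻¹ • X

/-- Raising the index of a covector: `ξ^α = m^{αβ} ξ_β`. -/
def raiseIndex {n : ℕ} (m : Matrix (Fin n) (Fin n) ℝ) (ξ : Fin n → ℝ) : Coord n :=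
  WithLp.toLp 2 (m⁻¹ *ᵥ ξ)

/-- The frame `F_i = ∂ψ/∂x^i` of a parametrization; `F i α = ∂ψ^α/∂x^i = ∇_i ψ^α`. -/
def tangentFrame {s n : ℕ} (ψ : Coord s → Coord n) (y : Coord s) : Fin s → Coord n :=
  fun i => fderiv ℝ ψ y (coordVec i)

/-- The induced metric `g_{ij} = m_{αβ} F_i^α F_j^β`. -/
def inducedMetric {s n : ℕ} (m : Matrix (Fin n) (Fin n) ℝ) (F : Fin s → Coord n) :
    Matrix (Fin s) (Fin s) ℝ :=
  Matrix.of fun i j => pairing m (F i) (F j)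

/-- The inclination determined by a frame `F`: the unit vector `n` with `m(n, F_i) = 0` for all
`i`, on the side where the covector `ξ` is positive. It is the direction of the component of `ξ^♯`
orthogonal to the span of the frame, `ξ^♯ - g^{ij} ξ(F_j) F_i`. -/
def unitNormal {s n : ℕ} (m : Matrix (Fin n) (Fin n) ℝ) (ξ : Fin n → ℝ)
    (F : Fin s → Coord n) : Coord n :=
  direction m (raiseIndex m ξ -
    ∑ i, ∑ j, ((inducedMetric m F)⁻¹ i j * ∑ α, ξ α * F j α) • F i)

/-- The energy density as a function of the derivatives `F_i^α = ∇_i ψ^α` of the embedding: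
`F ↦ γ(n(F))`. Here `γ` is the energy density at a fixed point, as a function of unit vectors. -/
def frameEnergy {s n : ℕ} (m : Matrix (Fin n) (Fin n) ℝ) (γ : Coord n → ℝ) (ξ : Fin n → ℝ)
    (F : Fin s → Coord n) : ℝ :=
  γ (unitNormal m ξ F)

/-- `∂γ/∂∇_iψ^β + γ g^{iq} m_{σβ} ∇_qψ^σ` at the frame `F`. -/
def stress {s n : ℕ} (m : Matrix (Fin n) (Fin n) ℝ) (γ : Coord n → ℝ) (ξ : Fin n → ℝ)
    (F : Fin s → Coord n) (i : Fin s) (β : Fin n) : ℝ :=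
  fderiv ℝ (frameEnergy m γ ξ) F (Pi.single i (coordVec β)) +
    frameEnergy m γ ξ F * ∑ q, ∑ σ, (inducedMetric m F)⁻¹ i q * m σ β * F q σ

/-- The vector
`A^α = m^{αβ} ∇_i (∂γ/∂∇_iψ^β + γ g^{iq} m_{σβ} ∇_qψ^σ)`
along the hypersurface parametrized by `ψ`, in coordinates. The index `i` is differentiated with
the Levi-Civita connection of the induced metric, the index `β` with that of the ambient metric
(pulled back along `ψ`):
`∇_k T^i_β = ∂_k T^i_β + Γ^i_{kj}(g) T^j_β - Γ^τ_{κβ}(m) ∂_kψ^κ T^i_τ`.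
The function `f` only fixes the side of the hypersurface to which the unit normal points. -/
def drivingCoord {s n : ℕ} (G : Coord n → Matrix (Fin n) (Fin n) ℝ)
    (γ : Coord n → Coord n → ℝ) (f : Coord n → ℝ) (ψ : Coord s → Coord n) (y : Coord s)
    (α : Fin n) : ℝ :=
  let T : Coord s → Fin s → Fin n → ℝ := fun x =>
    stress (G (ψ x)) (γ (ψ x)) (fun α' => pderiv f α' (ψ x)) (tangentFrame ψ x)
  let g : Coord s → Matrix (Fin s) (Fin s) ℝ := fun x =>
    inducedMetric (G (ψ x)) (tangentFrame ψ x)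
  ∑ β, (G (ψ y))⁻¹ α β * ∑ i,
    (pderiv (fun x => T x i β) i y
      + ∑ j, christoffel g y i i j * T y j β
      - ∑ κ, ∑ τ, christoffel G (ψ y) τ κ β * tangentFrame ψ y i κ * T y i τ)

/-- The energy density as a function of the gradient `ξ = ∇φ` of a level-set function,
`ξ ↦ γ(ξ^♯ / |ξ^♯|)`: the energy of the inclination `n = ∇φ / |∇φ|`. -/
def gradientEnergy {n : ℕ} (m : Matrix (Fin n) (Fin n) ℝ) (γ : Coord n → ℝ)
    (ξ : Fin n → ℝ) : ℝ :=
  γ (direction m (raiseIndex m ξ))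

/-- `γ m^{αβ} + ∂²γ/∂∇_βφ ∂∇_αφ` at the gradient `ξ = ∇φ`. -/
def diffusionTensor {n : ℕ} (m : Matrix (Fin n) (Fin n) ℝ) (γ : Coord n → ℝ)
    (ξ : Fin n → ℝ) (α β : Fin n) : ℝ :=
  gradientEnergy m γ ξ * m⁻¹ α β +
    fderiv ℝ (fun ξ' => fderiv ℝ (gradientEnergy m γ) ξ' (Pi.single α 1)) ξ (Pi.single β 1)

/-! ### Riemannian manifolds -/

section Manifold

variable {n : ℕ} {M : Type*} [TopologicalSpace M] [ChartedSpace (Coord n) M]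
  [IsManifold 𝓘(ℝ, Coord n) ∞ M]

/-- A smooth Riemannian metric on an `n`-manifold. -/
abbrev RMetric (n : ℕ) (M : Type*) [TopologicalSpace M] [ChartedSpace (Coord n) M]
    [IsManifold 𝓘(ℝ, Coord n) ∞ M] :=
  Bundle.ContMDiffRiemannianMetric 𝓘(ℝ, Coord n) ∞ (Coord n)
    (fun q : M => TangentSpace 𝓘(ℝ, Coord n) q)

/-- The components of a vector in `ℝⁿ` read as a tangent vector in the chart `Z`:
`X ↦ X^α ∂/∂Z^α` at the point with coordinates `z`. -/
def ofCoord (Z : OpenPartialHomeomorph M (Coord n)) (z : Coord n) (X : Coord n) :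
    TangentSpace 𝓘(ℝ, Coord n) (Z.symm z) :=
  mfderiv 𝓘(ℝ, Coord n) 𝓘(ℝ, Coord n) Z.symm z X

/-- The components `X^α` of a tangent vector `X` at `q` in the chart `Z`. -/
def component (Z : OpenPartialHomeomorph M (Coord n)) (q : M)
    (X : TangentSpace 𝓘(ℝ, Coord n) q) (α : Fin n) : ℝ :=
  let Y : Coord n := mfderiv 𝓘(ℝ, Coord n) 𝓘(ℝ, Coord n) Z q X
  Y α

/-- The metric components `m_{αβ}` in the chart `Z`. -/
def metricCoord (m : RMetric n M) (Z : OpenPartialHomeomorph M (Coord n)) (z : Coord n) :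
    Matrix (Fin n) (Fin n) ℝ :=
  Matrix.of fun α β => m.inner (Z.symm z) (ofCoord Z z (coordVec α)) (ofCoord Z z (coordVec β))

/-- An energy density, a function of unit tangent vectors (inclinations) of `M`, in the
chart `Z`. -/
def energyCoord (γ : TangentBundle 𝓘(ℝ, Coord n) M → ℝ)
    (Z : OpenPartialHomeomorph M (Coord n)) (z X : Coord n) : ℝ :=
  γ ⟨Z.symm z, ofCoord Z z X⟩

/-- The energy density `γ` is a smooth function of the inclination (unit tangent vector):
`X ↦ γ(X / |X|)` is smooth away from the zero vectors. Values of `γ` at vectors that are not unit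
vectors play no role. -/
def IsSmoothEnergy (m : RMetric n M) (γ : TangentBundle 𝓘(ℝ, Coord n) M → ℝ) : Prop :=
  ContMDiffOn (𝓘(ℝ, Coord n)).tangent 𝓘(ℝ, ℝ) ∞
    (fun v : TangentBundle 𝓘(ℝ, Coord n) M =>
      γ ⟨v.1, (Real.sqrt (m.inner v.1 v.2 v.2))⁻¹ • v.2⟩)
    {v | v.2 ≠ 0}

/-- The energy density depends on the inclination only, not explicitly on the position:
`γ` does not change when the inclination is transported parallel to itself, i.e. the horizontal
derivative `∂γ/∂z^α - Γ^σ_{αβ} X^β ∂γ/∂X^σ` of `(z, X) ↦ γ(z, X / |X|)` vanishes in every chart. In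
Euclidean space this says that `γ` is a function of the components of the unit normal alone. -/
def DependsOnInclinationOnly (m : RMetric n M) (γ : TangentBundle 𝓘(ℝ, Coord n) M → ℝ) : Prop :=
  ∀ Z ∈ IsManifold.maximalAtlas 𝓘(ℝ, Coord n) ∞ M, ∀ z ∈ Z.target, ∀ X : Coord n, X ≠ 0 →
    ∀ α : Fin n,
      pderiv (fun w => energyCoord γ Z w (direction (metricCoord m Z w) X)) α z
        - ∑ σ, ∑ β, christoffel (metricCoord m Z) z σ α β * X β *
            pderiv (fun Y => energyCoord γ Z z (direction (metricCoord m Z z) Y)) σ X = 0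

/-- The derivative `X^α ∇_α f` of a function in the direction of a tangent vector. -/
def directional (f : M → ℝ) (q : M) (X : TangentSpace 𝓘(ℝ, Coord n) q) : ℝ :=
  mfderiv 𝓘(ℝ, Coord n) 𝓘(ℝ, ℝ) f q X

/-- The gradient of `f` at `q` is a unit vector. -/
def HasUnitGradientAt (m : RMetric n M) (f : M → ℝ) (q : M) : Prop :=
  ∃ N : TangentSpace 𝓘(ℝ, Coord n) q,
    (∀ X : TangentSpace 𝓘(ℝ, Coord n) q, m.inner q N X = directional f q X) ∧
    m.inner q N N = 1

/-- The components `A^α`, in the chart `Z`, of the vector `A` of the hypersurface piece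
parametrized by `κ`, at the parameter `y`; the normal points to the side of increasing `f`. -/
def drivingVector {s : ℕ} (m : RMetric n M) (γ : TangentBundle 𝓘(ℝ, Coord n) M → ℝ) (f : M → ℝ)
    (κ : Coord s → M) (y : Coord s) (Z : OpenPartialHomeomorph M (Coord n)) (α : Fin n) : ℝ :=
  drivingCoord (metricCoord m Z) (energyCoord γ Z) (f ∘ Z.symm) (Z ∘ κ) y α

/-- `(γ m^{αβ} + ∂²γ/∂∇_βφ ∂∇_αφ) ∇_α ∇_β φ` at `q`, computed in the chart `Z`. -/
def anisotropicLaplacian (m : RMetric n M) (γ : TangentBundle 𝓘(ℝ, Coord n) M → ℝ) (f : M → ℝ)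
    (Z : OpenPartialHomeomorph M (Coord n)) (q : M) : ℝ :=
  ∑ α, ∑ β,
    diffusionTensor (metricCoord m Z (Z q)) (energyCoord γ Z (Z q))
      (fun α' => pderiv (f ∘ Z.symm) α' (Z q)) α β *
    covHessian (metricCoord m Z) (f ∘ Z.symm) (Z q) α β

/-- The time derivative `∂φ/∂t`, for times in `[0, 1]`. -/
def timeDeriv (φ : ℝ → M → ℝ) (t : ℝ) (q : M) : ℝ :=
  derivWithin (fun τ => φ τ q) (Icc 0 1) t

/-- The level-set transport equation `∂φ/∂t + v^α ∇_α φ = 0` at `(t, q)`. -/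
def TransportEq (φ : ℝ → M → ℝ) (t : ℝ) (q : M) (v : TangentSpace 𝓘(ℝ, Coord n) q) : Prop :=
  timeDeriv φ t q + directional (φ t) q v = 0

/-- The equation `∂φ/∂t - μ (γ m^{αβ} + ∂²γ/∂∇_βφ ∂∇_αφ) ∇_α ∇_β φ = 0` at `(t, q)`, in the
chart `Z`. -/
def DiffusionEq (m : RMetric n M) (γ : TangentBundle 𝓘(ℝ, Coord n) M → ℝ) (μ : ℝ)
    (φ : ℝ → M → ℝ) (t : ℝ) (q : M) (Z : OpenPartialHomeomorph M (Coord n)) : Prop :=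
  timeDeriv φ t q - μ * anisotropicLaplacian m γ (φ t) Z q = 0

end Manifold

end LevelSetFlow

end

noncomputable section

namespace LevelSetFlow

/-! ### Calculus of partial derivatives in coordinates -/

section PartialDerivatives

variable {n s : ℕ} {f g : Coord n → ℝ} {z : Coord n}

/-! Work in a chart, with `f` the level-set function. Since |∇f| = 1 on an open set, ν^α = m^{αβ}
∂_β f is a unit field extending the normal of every level set. Differentiating |ν|² = 1 gives ν_τ
∇_α ν^τ = 0; as the Hessian of `f` is symmetric, it annihilates ν, and ∇_ν ν = 0. Put u(z, X) = γ(z,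
X / |X|), which is homogeneous of degree 0 in X.

Varying a tangent frame tilts its normal only through the numbers ξ(F_j), which vanish at the frame
itself. Hence (`stress_eq`, `stressAlong_eq`) the stress is T^i_β = -ν_β V^i + γ g^{iq} m_{σβ}
F_q^σ, where V^i = g^{ik} F_k^σ ∂u/∂X^σ is `energyVector`. So ν^β T^i_β = -V^i, and the Leibniz rule
gives A^α ∂_α f = ν^β ∇_i T^i_β = -∇_i V^i - T^i_β ∇_i ν^β.

In the last term the part of T along ν drops out. The tangential part gives γ times the trace of the
Hessian over the hypersurface, which is its full trace because the Hessian annihilates ν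
(`tangential_trace`). In ∇_i V^i, the derivative of the frame is normal (`gauss_formula`), while
∂u/∂X annihilates ν by Euler's relation, so this contribution vanishes. What remains is the
derivative of ∂u/∂X along the surface. Because the horizontal derivative of u vanishes, only ∇ν
enters it (`pderiv_vertical_along`), and raising indices turns the result into ∂²γ/∂ξ∂ξ contracted
with the Hessian (`divergence_energyVector`).

The two terms add up to `sum_drivingCoord_mul_pderiv`. The argument is local on a single level set,
so it applies equally on and off the interface. The rest translates between manifold and charts. -/

theorem fderiv_eq_sum_pderiv (f : Coord n → ℝ) (z v : Coord n) :
    fderiv ℝ f z v = ∑ α, v α * pderiv f α z := by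
  have hv : v = ∑ α, v α • (coordVec α : Coord n) := by
    ext β
    simp [coordVec, Pi.single_apply]
  conv_lhs => rw [hv]
  simp [pderiv]

theorem pderiv_congr (h : f =ᶠ[𝓝 z] g) (α : Fin n) : pderiv f α z = pderiv g α z := by
  rw [pderiv, pderiv, h.fderiv_eq]

theorem pderiv_mul (hf : DifferentiableAt ℝ f z) (hg : DifferentiableAt ℝ g z) (α : Fin n) :
    pderiv (fun w => f w * g w) α z = f z * pderiv g α z + g z * pderiv f α z := by
  simp [pderiv, fderiv_fun_mul hf hg]

theorem pderiv_neg (f : Coord n → ℝ) (α : Fin n) (z : Coord n) :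
    pderiv (fun w => - f w) α z = - pderiv f α z := by
  simp [pderiv]

theorem pderiv_const (c : ℝ) (α : Fin n) (z : Coord n) :
    pderiv (fun _ => c) α z = 0 := by
  simp [pderiv]

theorem pderiv_sum {ι : Type*} {u : Finset ι} {f : ι → Coord n → ℝ}
    (hf : ∀ i ∈ u, DifferentiableAt ℝ (f i) z) (α : Fin n) :
    pderiv (fun w => ∑ i ∈ u, f i w) α z = ∑ i ∈ u, pderiv (f i) α z := by
  simp [pderiv, fderiv_fun_sum hf]

theorem pderiv_sum_mul {ι : Type*} {u : Finset ι} {f g : ι → Coord n → ℝ}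
    (hf : ∀ i ∈ u, DifferentiableAt ℝ (f i) z) (hg : ∀ i ∈ u, DifferentiableAt ℝ (g i) z)
    (α : Fin n) :
    pderiv (fun w => ∑ i ∈ u, f i w * g i w) α z =
      ∑ i ∈ u, (f i z * pderiv (g i) α z + g i z * pderiv (f i) α z) := by
  rw [pderiv_sum fun i hi => (hf i hi).fun_mul (hg i hi)]
  exact Finset.sum_congr rfl fun i hi => pderiv_mul (hf i hi) (hg i hi) α

theorem tangentFrame_apply {ψ : Coord s → Coord n} {y : Coord s} (hψ : DifferentiableAt ℝ ψ y)
    (i : Fin s) (κ : Fin n) : tangentFrame ψ y i κ = pderiv (fun x => ψ x κ) i y := by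
  have h : HasFDerivAt (fun x => ψ x κ) ((EuclideanSpace.proj κ : Coord n →L[ℝ] ℝ) ∘L fderiv ℝ ψ y) y :=
    (EuclideanSpace.proj κ : Coord n →L[ℝ] ℝ).hasFDerivAt.comp y hψ.hasFDerivAt
  simp [pderiv, h.fderiv, tangentFrame]

theorem pderiv_comp {ψ : Coord s → Coord n} {y : Coord s} (hf : DifferentiableAt ℝ f (ψ y))
    (hψ : DifferentiableAt ℝ ψ y) (i : Fin s) :
    pderiv (fun x => f (ψ x)) i y = ∑ κ, tangentFrame ψ y i κ * pderiv f κ (ψ y) := by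
  rw [← fderiv_eq_sum_pderiv, pderiv]
  have := fderiv_comp y hf hψ
  simp only [Function.comp_def] at this
  rw [this]; rfl

theorem contDiffAt_pderiv (hf : ContDiffAt ℝ ∞ f z) (α : Fin n) :
    ContDiffAt ℝ ∞ (pderiv f α) z :=
  (hf.fderiv_right (m := ∞) (by simp)).clm_apply contDiffAt_const

theorem pderiv_pderiv_comm (hf : ContDiffAt ℝ ∞ f z) (α β : Fin n) :
    pderiv (pderiv f β) α z = pderiv (pderiv f α) β z := by
  have h : DifferentiableAt ℝ (fderiv ℝ f) z :=
    (hf.fderiv_right (m := ∞) (by simp)).differentiableAt (by simp)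
  have hs : IsSymmSndFDerivAt ℝ f z :=
    (hf.of_le (m := 2) (by exact WithTop.coe_le_coe.2 le_top)).isSymmSndFDerivAt (by simp)
  have key : ∀ a b : Fin n, pderiv (pderiv f b) a z
      = fderiv ℝ (fderiv ℝ f) z (coordVec a) (coordVec b) := by
    intro a b
    have := fderiv_clm_apply (c := fderiv ℝ f) (u := fun _ => (coordVec b : Coord n)) h
      (differentiableAt_const _)
    change fderiv ℝ (fun z => fderiv ℝ f z (coordVec b)) z (coordVec a) = _
    rw [this]
    simp
  rw [key, key, hs.eq]

end PartialDerivatives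

/-! ### The Levi-Civita connection: torsion-freeness and metric compatibility -/

section LeviCivita

variable {n : ℕ} {G : Coord n → Matrix (Fin n) (Fin n) ℝ} {z : Coord n}

theorem christoffel_lower (hG : IsUnit (G z).det) (τ α β : Fin n) :
    ∑ σ, G z τ σ * christoffel G z σ α β =
      (1 / 2) * (pderiv (fun w => G w τ β) α z + pderiv (fun w => G w τ α) β z
        - pderiv (fun w => G w α β) τ z) := by
  have h : G z *ᵥ ((G z)⁻¹ *ᵥ fun κ => (1 / 2) * (pderiv (fun w => G w κ β) α z +
      pderiv (fun w => G w κ α) β z - pderiv (fun w => G w α β) κ z)) =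
      fun κ => (1 / 2) * (pderiv (fun w => G w κ β) α z +
      pderiv (fun w => G w κ α) β z - pderiv (fun w => G w α β) κ z) := by
    rw [Matrix.mulVec_mulVec, Matrix.mul_nonsing_inv _ hG, Matrix.one_mulVec]
  have := congrFun h τ
  rw [← this]
  simp only [Matrix.mulVec, dotProduct, christoffel]
  refine Finset.sum_congr rfl fun σ _ => ?_
  congr 1
  rw [Finset.mul_sum]
  exact Finset.sum_congr rfl fun κ _ => by ring

theorem pderiv_metric_symm (hs : ∀ᶠ w in 𝓝 z, (G w).IsSymm) (α β κ : Fin n) :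
    pderiv (fun w => G w α β) κ z = pderiv (fun w => G w β α) κ z :=
  pderiv_congr (hs.mono fun _ hw => hw.apply β α) κ

theorem christoffel_symm (hs : ∀ᶠ w in 𝓝 z, (G w).IsSymm) (σ α β : Fin n) :
    christoffel G z σ α β = christoffel G z σ β α := by
  unfold christoffel
  congr 1
  refine Finset.sum_congr rfl fun κ _ => ?_
  rw [pderiv_metric_symm hs α β]
  ring

/-- Metric compatibility: in the sum of the two Christoffel symbols of the first kind, four of the
six metric derivatives cancel by symmetry. -/
theorem pderiv_metric (hG : IsUnit (G z).det) (hs : ∀ᶠ w in 𝓝 z, (G w).IsSymm)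
    (α β κ : Fin n) :
    pderiv (fun w => G w α β) κ z =
      ∑ σ, G z α σ * christoffel G z σ κ β + ∑ σ, G z β σ * christoffel G z σ κ α := by
  rw [christoffel_lower hG, christoffel_lower hG, pderiv_metric_symm hs β α,
    pderiv_metric_symm hs κ α, pderiv_metric_symm hs κ β]
  ring

end LeviCivita

/-! ### Smooth dependence of the matrix and vector operations -/

section Smoothness

variable {E : Type*} [NormedAddCommGroup E] [NormedSpace ℝ E] {k : ℕ∞ω} {n s : ℕ} {x : E}

theorem contDiffAt_det {A : E → Matrix (Fin n) (Fin n) ℝ}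
    (hA : ∀ i j, ContDiffAt ℝ k (fun x => A x i j) x) :
    ContDiffAt ℝ k (fun x => (A x).det) x := by
  simp only [Matrix.det_apply]
  exact ContDiffAt.sum fun σ _ => (contDiffAt_prod fun i _ => hA _ _).const_smul _

/-- Cramer's rule: up to the inverse determinant, each entry is the determinant of the matrix with
one row replaced by a constant one. -/
theorem contDiffAt_inv_apply {A : E → Matrix (Fin n) (Fin n) ℝ}
    (hA : ∀ i j, ContDiffAt ℝ k (fun x => A x i j) x) (h : IsUnit (A x).det) (i j : Fin n) :
    ContDiffAt ℝ k (fun x => (A x)⁻¹ i j) x := by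
  simp only [Matrix.inv_def, Matrix.smul_apply, Ring.inverse_eq_inv', smul_eq_mul]
  refine ((contDiffAt_det hA).inv h.ne_zero).mul ?_
  simp only [Matrix.adjugate_apply]
  refine contDiffAt_det fun a b => ?_
  by_cases hab : a = j
  · subst hab
    simpa using contDiffAt_const
  · simpa [Matrix.updateRow_ne hab] using hA a b

theorem contDiffAt_coord {f : E → Coord n} (h : ContDiffAt ℝ k f x) (i : Fin n) :
    ContDiffAt ℝ k (fun x => f x i) x :=
  (EuclideanSpace.proj i : Coord n →L[ℝ] ℝ).contDiff.contDiffAt.comp x h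

theorem contDiffAt_pairing {m : E → Matrix (Fin n) (Fin n) ℝ} {X Y : E → Coord n}
    (hm : ∀ i j, ContDiffAt ℝ k (fun x => m x i j) x) (hX : ContDiffAt ℝ k X x)
    (hY : ContDiffAt ℝ k Y x) : ContDiffAt ℝ k (fun x => pairing (m x) (X x) (Y x)) x :=
  ContDiffAt.sum fun α _ => ContDiffAt.sum fun β _ =>
    ((hm α β).mul (contDiffAt_coord hX α)).mul (contDiffAt_coord hY β)

theorem contDiffAt_raiseIndex {m : E → Matrix (Fin n) (Fin n) ℝ} {ξ : E → Fin n → ℝ}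
    (hm : ∀ i j, ContDiffAt ℝ k (fun x => m x i j) x) (h : IsUnit (m x).det)
    (hξ : ∀ i, ContDiffAt ℝ k (fun x => ξ x i) x) :
    ContDiffAt ℝ k (fun x => raiseIndex (m x) (ξ x)) x := by
  rw [contDiffAt_euclidean]
  intro i
  simp only [raiseIndex, Matrix.mulVec, dotProduct]
  exact ContDiffAt.sum fun j _ => (contDiffAt_inv_apply hm h i j).mul (hξ j)

end Smoothness

/-! ### Linear algebra of frames and normals -/

section Pairing

variable {n s : ℕ} {m : Matrix (Fin n) (Fin n) ℝ}

theorem pairing_eq_dotProduct (m : Matrix (Fin n) (Fin n) ℝ) (X Y : Coord n) :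
    pairing m X Y = X.ofLp ⬝ᵥ m *ᵥ Y.ofLp := by
  simp only [pairing, dotProduct, Matrix.mulVec, Finset.mul_sum]
  exact Finset.sum_congr rfl fun _ _ => Finset.sum_congr rfl fun _ _ => by ring

theorem pairing_symm (hm : m.IsSymm) (X Y : Coord n) : pairing m X Y = pairing m Y X := by
  simp only [pairing]
  rw [Finset.sum_comm]
  exact Finset.sum_congr rfl fun a _ => Finset.sum_congr rfl fun b _ => by
    rw [hm.apply a b]; ring

theorem pairing_smul (m : Matrix (Fin n) (Fin n) ℝ) (c : ℝ) (X : Coord n) :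
    pairing m (c • X) (c • X) = c ^ 2 * pairing m X X := by
  simp only [pairing, Finset.mul_sum]
  exact Finset.sum_congr rfl fun _ _ => Finset.sum_congr rfl fun _ _ => by simp; ring

theorem direction_smul (m : Matrix (Fin n) (Fin n) ℝ) {c : ℝ} (hc : 0 < c) (X : Coord n) :
    direction m (c • X) = direction m X := by
  rw [direction, direction, pairing_smul, Real.sqrt_mul (by positivity), Real.sqrt_sq hc.le,
    smul_smul]
  congr 1
  field_simp

theorem pairing_raiseIndex (h : IsUnit m.det) (ξ : Fin n → ℝ) (X : Coord n) :
    pairing m X (raiseIndex m ξ) = ∑ α, ξ α * X α := by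
  rw [pairing_eq_dotProduct]
  simp only [raiseIndex, Matrix.mulVec_mulVec, Matrix.mul_nonsing_inv _ h, Matrix.one_mulVec,
    dotProduct]
  exact Finset.sum_congr rfl fun _ _ => mul_comm _ _

theorem sum_mul_raiseIndex (h : IsUnit m.det) (ξ : Fin n → ℝ) (α : Fin n) :
    ∑ β, m α β * raiseIndex m ξ β = ξ α := by
  have : m *ᵥ (m⁻¹ *ᵥ ξ) = ξ := by
    rw [Matrix.mulVec_mulVec, Matrix.mul_nonsing_inv _ h, Matrix.one_mulVec]
  exact congrFun this α

theorem inducedMetric_isSymm (hm : m.IsSymm) (F : Fin s → Coord n) :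
    (inducedMetric m F).IsSymm := by
  ext i j
  simpa [inducedMetric] using pairing_symm hm _ _

theorem inducedMetric_eq_mul (m : Matrix (Fin n) (Fin n) ℝ) (F : Fin s → Coord n) :
    inducedMetric m F = Matrix.of (fun i α => F i α) * m * (Matrix.of fun i α => F i α)ᵀ := by
  ext i j
  simp only [inducedMetric, Matrix.of_apply, pairing_eq_dotProduct, Matrix.mul_assoc]
  simp only [Matrix.mul_apply, dotProduct, Matrix.mulVec]
  rfl

/-- The Gram matrix is a congruence of `m` by the matrix of the frame, which has independent rows.
-/
theorem inducedMetric_posDef (hm : m.PosDef) {F : Fin s → Coord n} (hF : LinearIndependent ℝ F) :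
    (inducedMetric m F).PosDef := by
  rw [inducedMetric_eq_mul, ← Matrix.conjTranspose_eq_transpose_of_trivial]
  refine hm.mul_mul_conjTranspose_same (Matrix.vecMul_injective_iff.2 ?_)
  exact hF.map' (WithLp.linearEquiv 2 ℝ (Fin n → ℝ)).toLinearMap (LinearEquiv.ker _)

/-- The frame and the unit normal together form a basis: `g^{ij} F_i F_j + n n = m⁻¹`. -/
theorem frame_completeness {m : Matrix (Fin (s + 1)) (Fin (s + 1)) ℝ} (hs : m.IsSymm)
    {F : Fin s → Coord (s + 1)} {ν : Coord (s + 1)} (hg : IsUnit (inducedMetric m F).det)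
    (hν : pairing m ν ν = 1) (hF : ∀ i, pairing m (F i) ν = 0) (α β : Fin (s + 1)) :
    ∑ i, ∑ j, (inducedMetric m F)⁻¹ i j * F i α * F j β + ν α * ν β = m⁻¹ α β := by
  let A : Matrix (Fin s) (Fin (s + 1)) ℝ := Matrix.of fun i α => F i α
  let u : Matrix (Fin (s + 1)) Unit ℝ := Matrix.of fun α _ => ν α
  have hgA : inducedMetric m F = A * m * Aᵀ := inducedMetric_eq_mul m F
  have hAu : A * m * u = 0 := by
    ext i j
    have := hF i
    rw [pairing_eq_dotProduct] at this
    rw [Matrix.mul_assoc, Matrix.zero_apply, ← this]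
    simp only [Matrix.mul_apply, dotProduct, Matrix.mulVec]
    rfl
  have huu : uᵀ * m * u = 1 := by
    ext i j
    rw [pairing_eq_dotProduct] at hν
    rw [Matrix.mul_assoc, Subsingleton.elim i j, Matrix.one_apply_eq, ← hν]
    simp only [Matrix.mul_apply, dotProduct, Matrix.mulVec]
    rfl
  have huA : uᵀ * m * Aᵀ = 0 := by
    have := congrArg Matrix.transpose hAu
    rwa [Matrix.transpose_mul, Matrix.transpose_mul, hs.eq, ← Matrix.mul_assoc,
      Matrix.transpose_zero] at this
  -- The dual frame stacked on the conormal is a left inverse of the matrix with columns F_i and ν.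
  -- That matrix is square, with s + 1 columns, so the product in the other order is also the
  -- identity, and this is the completeness relation.
  have hLP : Matrix.fromRows ((inducedMetric m F)⁻¹ * A * m) (uᵀ * m) *
      Matrix.fromCols Aᵀ u = 1 := by
    rw [Matrix.fromRows_mul_fromCols, huA, huu, Matrix.mul_assoc, Matrix.mul_assoc,
      ← Matrix.mul_assoc A m, ← hgA, Matrix.nonsing_inv_mul _ hg, Matrix.mul_assoc,
      Matrix.mul_assoc, ← Matrix.mul_assoc A m, hAu, Matrix.mul_zero, Matrix.fromBlocks_one]
  rw [← Matrix.fromCols_mul_fromRows_eq_one_comm (Fintype.equivOfCardEq (by simp)),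
    Matrix.fromCols_mul_fromRows] at hLP
  have hfin : Aᵀ * ((inducedMetric m F)⁻¹ * A) + u * uᵀ = m⁻¹ := by
    refine (Matrix.inv_eq_left_inv ?_).symm
    rw [Matrix.add_mul, ← hLP]
    simp only [Matrix.mul_assoc]
  rw [← hfin]
  simp only [Matrix.add_apply, Matrix.mul_apply, Finset.univ_unique, Finset.sum_singleton,
    Finset.mul_sum, Matrix.transpose_apply]
  congr 1
  refine Finset.sum_congr rfl fun i _ => Finset.sum_congr rfl fun j _ => ?_
  change _ = F i α * (_ * F j β)
  ring

end Pairing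

/-! ### Covariant derivative and divergence of vector fields -/

section CovariantDerivative

variable {n : ℕ} {G : Coord n → Matrix (Fin n) (Fin n) ℝ} {V c : Coord n → Fin n → ℝ}
  {z : Coord n}

/-- The covariant derivative `∇_i V^j` of a vector field. -/
def covDeriv (G : Coord n → Matrix (Fin n) (Fin n) ℝ) (V : Coord n → Fin n → ℝ) (z : Coord n)
    (i j : Fin n) : ℝ :=
  pderiv (fun w => V w j) i z + ∑ l, christoffel G z j i l * V z l

/-- The covariant derivative commutes with lowering an index. -/
theorem covDeriv_lower (hdG : ∀ i j, DifferentiableAt ℝ (fun w => G w i j) z)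
    (hG : IsUnit (G z).det) (hs : ∀ᶠ w in 𝓝 z, (G w).IsSymm)
    (hV : ∀ j, DifferentiableAt ℝ (fun w => V w j) z)
    (hc : ∀ᶠ w in 𝓝 z, ∀ k, c w k = ∑ j, G w k j * V w j) (i k : Fin n) :
    pderiv (fun w => c w k) i z - ∑ l, christoffel G z l i k * c z l =
      ∑ j, G z k j * covDeriv G V z i j := by
  have h1 : pderiv (fun w => c w k) i z = ∑ j, (G z k j * pderiv (fun w => V w j) i z +
      V z j * pderiv (fun w => G w k j) i z) := by
    rw [pderiv_congr (hc.mono fun w hw => hw k)]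
    exact pderiv_sum_mul (fun j _ => hdG k j) (fun j _ => hV j) i
  rw [h1]
  simp only [pderiv_metric hG hs, covDeriv, hc.self_of_nhds]
  have h2 : ∑ j, V z j * ∑ σ, G z j σ * christoffel G z σ i k =
      ∑ l, christoffel G z l i k * ∑ j, G z l j * V z j := by
    simp only [Finset.mul_sum]
    rw [Finset.sum_comm]
    refine Finset.sum_congr rfl fun a _ => Finset.sum_congr rfl fun b _ => ?_
    rw [hs.self_of_nhds.apply a b]
    ring
  have h3 : ∑ j, V z j * ∑ σ, G z k σ * christoffel G z σ i j =
      ∑ j, G z k j * ∑ l, christoffel G z j i l * V z l := by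
    simp only [Finset.mul_sum]
    rw [Finset.sum_comm]
    exact Finset.sum_congr rfl fun a _ => Finset.sum_congr rfl fun b _ => by ring
  simp only [mul_add, Finset.sum_add_distrib, h2, h3]
  ring

/-- The divergence of a vector field in terms of the covariant derivative of the corresponding
covector field. -/
theorem divergence_eq (hdG : ∀ i j, DifferentiableAt ℝ (fun w => G w i j) z)
    (hG : IsUnit (G z).det) (hs : ∀ᶠ w in 𝓝 z, (G w).IsSymm)
    (hV : ∀ j, DifferentiableAt ℝ (fun w => V w j) z)
    (hc : ∀ᶠ w in 𝓝 z, ∀ k, c w k = ∑ j, G w k j * V w j) :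
    ∑ i, covDeriv G V z i i = ∑ i, ∑ k, (G z)⁻¹ i k *
      (pderiv (fun w => c w k) i z - ∑ l, christoffel G z l i k * c z l) := by
  refine Finset.sum_congr rfl fun i _ => ?_
  have h : (G z)⁻¹ *ᵥ (G z *ᵥ covDeriv G V z i) = covDeriv G V z i := by
    rw [Matrix.mulVec_mulVec, Matrix.nonsing_inv_mul _ hG, Matrix.one_mulVec]
  conv_lhs => rw [← h]
  simp only [covDeriv_lower hdG hG hs hV hc, Matrix.mulVec, dotProduct]

/-- The covariant derivative of a field of unit vectors is orthogonal to the field. -/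
theorem sum_mul_covDeriv_eq_zero (hdG : ∀ i j, DifferentiableAt ℝ (fun w => G w i j) z)
    (hG : IsUnit (G z).det) (hs : ∀ᶠ w in 𝓝 z, (G w).IsSymm)
    (hV : ∀ j, DifferentiableAt ℝ (fun w => V w j) z)
    (hdc : ∀ j, DifferentiableAt ℝ (fun w => c w j) z)
    (hc : ∀ᶠ w in 𝓝 z, ∀ k, c w k = ∑ j, G w k j * V w j)
    (hu : ∀ᶠ w in 𝓝 z, ∑ k, c w k * V w k = 1) (i : Fin n) :
    ∑ j, c z j * covDeriv G V z i j = 0 := by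
  have h1 : ∑ k, (c z k * pderiv (fun w => V w k) i z + V z k * pderiv (fun w => c w k) i z)
      = 0 := by
    rw [← pderiv_const 1 i z, ← pderiv_congr hu i]
    exact (pderiv_sum_mul (fun k _ => hdc k) (fun k _ => hV k) i).symm
  have h2 : ∀ k, pderiv (fun w => c w k) i z =
      ∑ j, G z k j * covDeriv G V z i j + ∑ l, christoffel G z l i k * c z l := fun k => by
    rw [← covDeriv_lower hdG hG hs hV hc]; ring
  -- By metric compatibility both terms of the product rule for c(V) = 1 carry the same covariant
  -- content, so the relation reads 2 c(∇V) = 0.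
  simp only [h2, mul_add, Finset.sum_add_distrib] at h1
  have h3 : ∑ k, V z k * ∑ j, G z k j * covDeriv G V z i j =
      ∑ j, c z j * covDeriv G V z i j := by
    simp only [hc.self_of_nhds, Finset.mul_sum, Finset.sum_mul]
    rw [Finset.sum_comm]
    refine Finset.sum_congr rfl fun a _ => Finset.sum_congr rfl fun b _ => ?_
    rw [hs.self_of_nhds.apply a b]
    ring
  have h4 : ∑ k, V z k * ∑ l, christoffel G z l i k * c z l =
      ∑ j, c z j * ∑ l, christoffel G z j i l * V z l := by
    simp only [Finset.mul_sum]
    rw [Finset.sum_comm]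
    exact Finset.sum_congr rfl fun a _ => Finset.sum_congr rfl fun b _ => by ring
  have h5 : ∑ j, c z j * covDeriv G V z i j = ∑ k, c z k * pderiv (fun w => V w k) i z +
      ∑ j, c z j * ∑ l, christoffel G z j i l * V z l := by
    simp only [covDeriv, mul_add, Finset.sum_add_distrib]
  linarith

end CovariantDerivative

/-! ### The Gauss formula -/

section Gauss

variable {n s : ℕ} {G : Coord n → Matrix (Fin n) (Fin n) ℝ} {ψ : Coord s → Coord n} {y : Coord s}

/-- The acceleration `∂_i∂_jψ^τ + Γ^τ_{αβ} ∂_iψ^α ∂_jψ^β` of a parametrization. -/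
def frameDeriv (G : Coord n → Matrix (Fin n) (Fin n) ℝ) (ψ : Coord s → Coord n) (y : Coord s)
    (i j : Fin s) (τ : Fin n) : ℝ :=
  pderiv (fun x => tangentFrame ψ x j τ) i y +
    ∑ α, ∑ β, christoffel G (ψ y) τ α β * tangentFrame ψ y i α * tangentFrame ψ y j β

theorem contDiffAt_tangentFrame (hψ : ContDiffAt ℝ ∞ ψ y) (j : Fin s) :
    ContDiffAt ℝ ∞ (fun x => tangentFrame ψ x j) y :=
  (hψ.fderiv_right (m := ∞) (by simp)).clm_apply contDiffAt_const

theorem contDiffAt_tangentFrame_coord (hψ : ContDiffAt ℝ ∞ ψ y) (j : Fin s) (τ : Fin n) :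
    ContDiffAt ℝ ∞ (fun x => tangentFrame ψ x j τ) y :=
  contDiffAt_coord (contDiffAt_tangentFrame hψ j) τ

theorem eventually_differentiableAt {E F : Type*} [NormedAddCommGroup E] [NormedSpace ℝ E]
    [NormedAddCommGroup F] [NormedSpace ℝ F] {f : E → F} {x : E} (hf : ContDiffAt ℝ ∞ f x) :
    ∀ᶠ x' in 𝓝 x, DifferentiableAt ℝ f x' :=
  ((hf.of_le (m := 1) (by exact WithTop.coe_le_coe.2 le_top)).eventually (by simp)).mono
    fun _ h => h.differentiableAt (by simp)

/-- Second partial derivatives of `ψ` commute and the ambient connection is torsion-free. -/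
theorem frameDeriv_symm (hψ : ContDiffAt ℝ ∞ ψ y) (hs : ∀ᶠ w in 𝓝 (ψ y), (G w).IsSymm)
    (i j : Fin s) (τ : Fin n) : frameDeriv G ψ y i j τ = frameDeriv G ψ y j i τ := by
  have h : ∀ j : Fin s, (fun x => tangentFrame ψ x j τ) =ᶠ[𝓝 y] pderiv (fun x => ψ x τ) j :=
    fun j => (eventually_differentiableAt hψ).mono fun x hx => tangentFrame_apply hx j τ
  rw [frameDeriv, frameDeriv, pderiv_congr (h j), pderiv_congr (h i),
    pderiv_pderiv_comm (contDiffAt_coord hψ τ), Finset.sum_comm]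
  congr 1
  refine Finset.sum_congr rfl fun a _ => Finset.sum_congr rfl fun b _ => ?_
  rw [christoffel_symm hs τ a b]
  ring

/-- `∂_i g_{jl} = m(∇_i F_j, F_l) + m(F_j, ∇_i F_l)`. -/
theorem pderiv_inducedMetric (hψ : ContDiffAt ℝ ∞ ψ y)
    (hdG : ∀ i j, DifferentiableAt ℝ (fun w => G w i j) (ψ y)) (hG : IsUnit (G (ψ y)).det)
    (hs : ∀ᶠ w in 𝓝 (ψ y), (G w).IsSymm) (i j l : Fin s) :
    pderiv (fun x => inducedMetric (G (ψ x)) (tangentFrame ψ x) j l) i y =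
      ∑ α, ∑ β, G (ψ y) α β * tangentFrame ψ y l α * frameDeriv G ψ y i j β +
      ∑ α, ∑ β, G (ψ y) α β * tangentFrame ψ y j α * frameDeriv G ψ y i l β := by
  have hdψ : DifferentiableAt ℝ ψ y := hψ.differentiableAt (by simp)
  have hdF : ∀ j τ, DifferentiableAt ℝ (fun x => tangentFrame ψ x j τ) y := fun j τ =>
    (contDiffAt_tangentFrame_coord hψ j τ).differentiableAt (by simp)
  have hdGψ : ∀ α β, DifferentiableAt ℝ (fun x => G (ψ x) α β) y := fun α β =>
    DifferentiableAt.fun_comp' (f := ψ) y (hdG α β) hdψ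
  have h1 : pderiv (fun x => inducedMetric (G (ψ x)) (tangentFrame ψ x) j l) i y =
      ∑ α, ∑ β, (G (ψ y) α β * tangentFrame ψ y j α * pderiv (fun x => tangentFrame ψ x l β) i y
        + tangentFrame ψ y l β * (G (ψ y) α β * pderiv (fun x => tangentFrame ψ x j α) i y +
          tangentFrame ψ y j α * ∑ κ, tangentFrame ψ y i κ *
            (∑ σ, G (ψ y) α σ * christoffel G (ψ y) σ κ β +
              ∑ σ, G (ψ y) β σ * christoffel G (ψ y) σ κ α))) := by
    simp only [inducedMetric, pairing, Matrix.of_apply]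
    rw [pderiv_sum fun α _ => DifferentiableAt.fun_sum fun β _ =>
      ((hdGψ α β).fun_mul (hdF j α)).fun_mul (hdF l β)]
    refine Finset.sum_congr rfl fun α _ => ?_
    rw [pderiv_sum_mul (fun β _ => (hdGψ α β).fun_mul (hdF j α)) (fun β _ => hdF l β)]
    refine Finset.sum_congr rfl fun β _ => ?_
    rw [pderiv_mul (hdGψ α β) (hdF j α), pderiv_comp (f := fun w => G w α β) (hdG α β) hdψ]
    simp only [pderiv_metric hG hs]
  -- Each of the two Christoffel sums produced by metric compatibility completes the plain
  -- derivative of one frame vector to its covariant derivative.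
  have h2 : ∀ a b : Fin s, ∑ α, ∑ β, tangentFrame ψ y b β * (tangentFrame ψ y a α *
      ∑ κ, tangentFrame ψ y i κ * ∑ σ, G (ψ y) α σ * christoffel G (ψ y) σ κ β) =
      ∑ α, ∑ β, G (ψ y) α β * tangentFrame ψ y a α * ∑ α', ∑ β', christoffel G (ψ y) β α' β' *
        tangentFrame ψ y i α' * tangentFrame ψ y b β' := by
    intro a b
    refine Finset.sum_congr rfl fun α _ => ?_
    simp only [Finset.mul_sum]
    rw [Finset.sum_comm]
    conv_lhs => enter [2, κ]; rw [Finset.sum_comm]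
    rw [Finset.sum_comm]
    exact Finset.sum_congr rfl fun _ _ => Finset.sum_congr rfl fun _ _ =>
      Finset.sum_congr rfl fun _ _ => by ring
  have h3 := h2 l j
  rw [Finset.sum_comm] at h3
  have h4 : ∑ α, ∑ β, tangentFrame ψ y l β * (tangentFrame ψ y j α *
      ∑ κ, tangentFrame ψ y i κ * ∑ σ, G (ψ y) β σ * christoffel G (ψ y) σ κ α) =
      ∑ α, ∑ β, G (ψ y) α β * tangentFrame ψ y l α * ∑ α', ∑ β', christoffel G (ψ y) β α' β' *
        tangentFrame ψ y i α' * tangentFrame ψ y j β' := by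
    rw [← h3]
    exact Finset.sum_congr rfl fun _ _ => Finset.sum_congr rfl fun _ _ => by ring
  have h5 : ∑ α, ∑ β, tangentFrame ψ y l β * (G (ψ y) α β *
      pderiv (fun x => tangentFrame ψ x j α) i y) =
      ∑ α, ∑ β, G (ψ y) α β * tangentFrame ψ y l α *
      pderiv (fun x => tangentFrame ψ x j β) i y := by
    rw [Finset.sum_comm]
    refine Finset.sum_congr rfl fun a _ => Finset.sum_congr rfl fun b _ => ?_
    rw [hs.self_of_nhds.apply a b]; ring
  rw [h1]
  simp only [frameDeriv, mul_add, Finset.sum_add_distrib, ← h2 j l, ← h4, ← h5]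
  ring

/-- Gauss formula: `∇_i F_j - Γ^k_{ij} F_k` is orthogonal to the hypersurface. -/
theorem gauss_formula (hψ : ContDiffAt ℝ ∞ ψ y)
    (hdG : ∀ i j, DifferentiableAt ℝ (fun w => G w i j) (ψ y)) (hG : IsUnit (G (ψ y)).det)
    (hs : ∀ᶠ w in 𝓝 (ψ y), (G w).IsSymm)
    (hg : IsUnit (inducedMetric (G (ψ y)) (tangentFrame ψ y)).det) (i j l : Fin s) :
    ∑ α, ∑ β, G (ψ y) α β * tangentFrame ψ y l α * (frameDeriv G ψ y i j β -
      ∑ k, christoffel (fun x => inducedMetric (G (ψ x)) (tangentFrame ψ x)) y k i j *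
        tangentFrame ψ y k β) = 0 := by
  have h1 := christoffel_lower (G := fun x => inducedMetric (G (ψ x)) (tangentFrame ψ x))
    hg l i j
  simp only [pderiv_inducedMetric hψ hdG hG hs] at h1
  -- Koszul's argument: once the lower indices are interchanged, four of the six products m(∇F, F)
  -- cancel and the other two both equal m(∇_i F_j, F_l), which absorbs the factor 1/2.
  simp only [frameDeriv_symm hψ hs l, frameDeriv_symm hψ hs j i] at h1
  have h2 : ∑ α, ∑ β, G (ψ y) α β * tangentFrame ψ y l α * ∑ k,
      christoffel (fun x => inducedMetric (G (ψ x)) (tangentFrame ψ x)) y k i j *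
        tangentFrame ψ y k β = ∑ k, inducedMetric (G (ψ y)) (tangentFrame ψ y) l k *
      christoffel (fun x => inducedMetric (G (ψ x)) (tangentFrame ψ x)) y k i j := by
    simp only [inducedMetric, pairing, Matrix.of_apply, Finset.mul_sum, Finset.sum_mul]
    conv_lhs => enter [2, α]; rw [Finset.sum_comm]
    rw [Finset.sum_comm]
    exact Finset.sum_congr rfl fun _ _ => Finset.sum_congr rfl fun _ _ =>
      Finset.sum_congr rfl fun _ _ => by ring
  simp only [mul_sub, Finset.sum_sub_distrib, h2, h1]
  ring

end Gauss

/-! ### First variation of the energy with respect to the frame -/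

section Stress

variable {n s : ℕ} {m : Matrix (Fin n) (Fin n) ℝ} {γ : Coord n → ℝ} {ξ : Fin n → ℝ}
  {F : Fin s → Coord n}

theorem unitNormal_eq (hF : ∀ j, ∑ α, ξ α * F j α = 0) :
    unitNormal m ξ F = direction m (raiseIndex m ξ) := by
  simp [unitNormal, hF]

theorem contDiffAt_inducedMetric_apply (m : Matrix (Fin n) (Fin n) ℝ) (F : Fin s → Coord n)
    (i j : Fin s) : ContDiffAt ℝ ∞ (fun F' : Fin s → Coord n => inducedMetric m F' i j) F := by
  simp only [inducedMetric, Matrix.of_apply]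
  exact contDiffAt_pairing (fun _ _ => contDiffAt_const) (contDiff_apply ℝ (Coord n) i).contDiffAt
    (contDiff_apply ℝ (Coord n) j).contDiffAt

/-- First variation of the normal component of a covector at a frame annihilated by it. -/
theorem hasFDerivAt_normalComponent (hg : IsUnit (inducedMetric m F).det)
    (hF : ∀ j, ∑ α, ξ α * F j α = 0) :
    HasFDerivAt (fun F' : Fin s → Coord n => raiseIndex m ξ -
      ∑ i, ∑ j, ((inducedMetric m F')⁻¹ i j * ∑ α, ξ α * F' j α) • F' i)
      (-∑ i, ∑ j, ((inducedMetric m F)⁻¹ i j • ∑ α, ξ α •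
        ((EuclideanSpace.proj α : Coord n →L[ℝ] ℝ) ∘L
          (ContinuousLinearMap.proj j : (Fin s → Coord n) →L[ℝ] Coord n))).smulRight (F i)) F := by
  rw [← zero_sub]
  refine (hasFDerivAt_const _ _).sub
    (HasFDerivAt.fun_sum fun i _ => HasFDerivAt.fun_sum fun j _ => ?_)
  have ha := ((contDiffAt_inv_apply (fun a b => contDiffAt_inducedMetric_apply m F a b) hg
    i j).differentiableAt (by simp)).hasFDerivAt
  have hb : HasFDerivAt (fun F' : Fin s → Coord n => ∑ α, ξ α * F' j α)
      (∑ α, ξ α • ((EuclideanSpace.proj α : Coord n →L[ℝ] ℝ) ∘L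
          (ContinuousLinearMap.proj j : (Fin s → Coord n) →L[ℝ] Coord n))) F :=
    HasFDerivAt.fun_sum fun α _ => HasFDerivAt.const_mul
      ((EuclideanSpace.proj α : Coord n →L[ℝ] ℝ) ∘L
          (ContinuousLinearMap.proj j : (Fin s → Coord n) →L[ℝ] Coord n)).hasFDerivAt _
  have hc : HasFDerivAt (fun F' : Fin s → Coord n => F' i)
    (ContinuousLinearMap.proj i : (Fin s → Coord n) →L[ℝ] Coord n) F :=
    (ContinuousLinearMap.proj i : (Fin s → Coord n) →L[ℝ] Coord n).hasFDerivAt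
  -- Terms in which g^{ij} or F_i is varied keep the factor ξ(F_j), which is zero at `F`; only the
  -- variation of ξ(F_j) survives.
  have := (ha.fun_mul hb).fun_smul hc
  simpa [hF j] using this

/-- Moving F_i in the direction e_β tilts the unnormalised normal by -ξ_β g^{ki} F_k. Its length
need not be tracked, because `direction` is applied before `γ`. -/
theorem fderiv_frameEnergy (hg : IsUnit (inducedMetric m F).det)
    (hF : ∀ j, ∑ α, ξ α * F j α = 0)
    (hγ : DifferentiableAt ℝ (fun X => γ (direction m X)) (raiseIndex m ξ)) (i : Fin s)
    (β : Fin n) :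
    fderiv ℝ (frameEnergy m γ ξ) F (Pi.single i (coordVec β)) =
      - ∑ k, ξ β * ((inducedMetric m F)⁻¹ k i *
        fderiv ℝ (fun X => γ (direction m X)) (raiseIndex m ξ) (F k)) := by
  have h0 : raiseIndex m ξ - ∑ i, ∑ j, ((inducedMetric m F)⁻¹ i j * ∑ α, ξ α * F j α) • F i
      = raiseIndex m ξ := by simp [hF]
  have h := HasFDerivAt.comp F (h0.symm ▸ hγ.hasFDerivAt) (hasFDerivAt_normalComponent hg hF)
  have h' : HasFDerivAt (frameEnergy m γ ξ) _ F := h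
  rw [h'.fderiv]
  have h1 : ∀ j α, (Pi.single i (coordVec β) : Fin s → Coord n) j α =
      if j = i then (if α = β then 1 else 0) else 0 := by
    intro j α
    by_cases hj : j = i
    · subst hj; simp [coordVec]
    · simp [hj]
  simp [h1, h0]
  refine Finset.sum_congr rfl fun k _ => ?_
  ring

theorem stress_eq (hg : IsUnit (inducedMetric m F).det)
    (hF : ∀ j, ∑ α, ξ α * F j α = 0)
    (hγ : DifferentiableAt ℝ (fun X => γ (direction m X)) (raiseIndex m ξ)) (i : Fin s)
    (β : Fin n) :
    stress m γ ξ F i β =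
      - ∑ k, ξ β * ((inducedMetric m F)⁻¹ k i *
        fderiv ℝ (fun X => γ (direction m X)) (raiseIndex m ξ) (F k)) +
      γ (direction m (raiseIndex m ξ)) *
        ∑ q, ∑ σ, (inducedMetric m F)⁻¹ i q * m σ β * F q σ := by
  rw [stress, fderiv_frameEnergy hg hF hγ, frameEnergy, unitNormal_eq hF]

end Stress

/-! ### The energy as a function of the gradient -/

section Gradient

variable {n : ℕ} {m : Matrix (Fin n) (Fin n) ℝ} {γ : Coord n → ℝ} {ξ : Fin n → ℝ}

/-- A function of the direction alone has vanishing radial derivative. -/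
theorem fderiv_direction_self (m : Matrix (Fin n) (Fin n) ℝ) (γ : Coord n → ℝ) {X : Coord n}
    (hγ : DifferentiableAt ℝ (fun X => γ (direction m X)) X) :
    fderiv ℝ (fun X => γ (direction m X)) X X = 0 := by
  have h1 : HasDerivAt (fun t : ℝ => t • X) X 1 := by
    simpa using (hasDerivAt_id (1 : ℝ)).smul_const X
  have h2 := HasFDerivAt.comp_hasDerivAt (f := fun t : ℝ => t • X) (1 : ℝ)
    (by simpa using hγ.hasFDerivAt) h1
  have h3 : HasDerivAt (fun t : ℝ => γ (direction m (t • X))) 0 1 := by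
    -- The direction is constant along the open ray through X, and t stays positive near 1.
    refine (hasDerivAt_const (1 : ℝ) (γ (direction m X))).congr_of_eventuallyEq ?_
    filter_upwards [lt_mem_nhds (zero_lt_one (α := ℝ))] with t ht
    rw [direction_smul m ht]
  exact h2.unique h3

/-- `raiseIndex` as a continuous linear map. -/
def raiseIndexL (m : Matrix (Fin n) (Fin n) ℝ) : (Fin n → ℝ) →L[ℝ] Coord n :=
  LinearMap.toContinuousLinearMap
    ((WithLp.linearEquiv 2 ℝ (Fin n → ℝ)).symm.toLinearMap ∘ₗ Matrix.mulVecLin m⁻¹)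

theorem raiseIndexL_apply (m : Matrix (Fin n) (Fin n) ℝ) (ξ : Fin n → ℝ) :
    raiseIndexL m ξ = raiseIndex m ξ := rfl

theorem raiseIndex_single (m : Matrix (Fin n) (Fin n) ℝ) (α σ : Fin n) :
    raiseIndex m (Pi.single α 1) σ = m⁻¹ σ α := by
  simp [raiseIndex]

/-- The second derivative with respect to the gradient, in terms of the one with respect to the
normal. -/
theorem fderiv_fderiv_gradientEnergy
    (hγ : ContDiffAt ℝ ∞ (fun X => γ (direction m X)) (raiseIndex m ξ)) (α β : Fin n) :
    fderiv ℝ (fun ξ' => fderiv ℝ (gradientEnergy m γ) ξ' (Pi.single α 1)) ξ (Pi.single β 1) =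
      ∑ σ, ∑ τ, m⁻¹ σ α * m⁻¹ τ β *
        pderiv (pderiv (fun X => γ (direction m X)) σ) τ (raiseIndex m ξ) := by
  have h1 : (fun ξ' => fderiv ℝ (gradientEnergy m γ) ξ' (Pi.single α 1)) =ᶠ[𝓝 ξ]
      fun ξ' => ∑ σ, m⁻¹ σ α * pderiv (fun X => γ (direction m X)) σ (raiseIndexL m ξ') := by
    have hev := (raiseIndexL m).continuous.continuousAt.eventually
      (eventually_differentiableAt (x := raiseIndexL m ξ) hγ)
    filter_upwards [hev] with ξ' h
    have := (h.hasFDerivAt.comp ξ' (raiseIndexL m).hasFDerivAt).fderiv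
    change fderiv ℝ (gradientEnergy m γ) ξ' = _ at this
    rw [this, ContinuousLinearMap.comp_apply, fderiv_eq_sum_pderiv]
    simp [raiseIndexL_apply, raiseIndex_single]
  have h2 : ∀ σ, HasFDerivAt
      (fun ξ' => m⁻¹ σ α * pderiv (fun X => γ (direction m X)) σ (raiseIndexL m ξ'))
      (m⁻¹ σ α • ((fderiv ℝ (pderiv (fun X => γ (direction m X)) σ) (raiseIndexL m ξ)) ∘L
        raiseIndexL m)) ξ := fun σ =>
    (((contDiffAt_pderiv hγ σ).differentiableAt (by simp)).hasFDerivAt.comp ξ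
      (raiseIndexL m).hasFDerivAt).const_mul _
  rw [h1.fderiv_eq, (HasFDerivAt.fun_sum fun σ _ => h2 σ).fderiv]
  simp only [sum_apply, smul_apply,
    ContinuousLinearMap.comp_apply, fderiv_eq_sum_pderiv _ (raiseIndex m ξ), smul_eq_mul,
    Finset.mul_sum, raiseIndexL_apply, raiseIndex_single, mul_assoc]

end Gradient

/-! ### Vertical derivatives when the horizontal derivative vanishes -/

section VerticalDerivative

variable {n s : ℕ} {u : Coord n × Coord n → ℝ} {z X : Coord n}

/-- Here and in `pderiv_base`, a partial derivative is read off the joint differential, so that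
symmetry of the second derivative can interchange base and vertical directions. -/
theorem pderiv_vertical {p : Coord n × Coord n} (hu : DifferentiableAt ℝ u p) (σ : Fin n) :
    pderiv (fun Y => u (p.1, Y)) σ p.2 = fderiv ℝ u p (0, coordVec σ) := by
  have h := HasFDerivAt.comp (f := fun Y : Coord n => (p.1, Y)) p.2 hu.hasFDerivAt
    (hasFDerivAt_prodMk_right p.1 p.2)
  have h' : HasFDerivAt (fun Y => u (p.1, Y)) _ p.2 := h
  simp [pderiv, h'.fderiv]

theorem pderiv_base {p : Coord n × Coord n} (hu : DifferentiableAt ℝ u p) (α : Fin n) :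
    pderiv (fun w => u (w, p.2)) α p.1 = fderiv ℝ u p (coordVec α, 0) := by
  have h := HasFDerivAt.comp (f := fun w : Coord n => (w, p.2)) p.1 hu.hasFDerivAt
    (hasFDerivAt_prodMk_left p.1 p.2)
  have h' : HasFDerivAt (fun w => u (w, p.2)) _ p.1 := h
  simp [pderiv, h'.fderiv]

theorem hasFDerivAt_fderiv_apply {E : Type*} [NormedAddCommGroup E] [NormedSpace ℝ E]
    {f : E → ℝ} {x : E} (hf : ContDiffAt ℝ ∞ f x) (v : E) :
    HasFDerivAt (fun x => fderiv ℝ f x v) ((fderiv ℝ (fderiv ℝ f) x).flip v) x := by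
  have h : DifferentiableAt ℝ (fderiv ℝ f) x :=
    (hf.fderiv_right (m := ∞) (by simp)).differentiableAt (by simp)
  simpa using h.hasFDerivAt.clm_apply (hasFDerivAt_const v x)

theorem contDiffAt_vertical (hu : ContDiffAt ℝ ∞ u (z, X)) :
    ContDiffAt ℝ ∞ (fun Y => u (z, Y)) X :=
  ContDiffAt.comp X hu (contDiffAt_const.prodMk contDiffAt_id)

/-- The derivative of the vertical derivatives of `u` along a field `N` of vectors over `ψ`, when
the horizontal derivative of `u` vanishes at `ψ y`. -/
theorem pderiv_vertical_along {Γ : Fin n → Fin n → Fin n → ℝ} (hX : X ≠ 0)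
    (hu : ContDiffAt ℝ ∞ u (z, X))
    (hh : ∀ Y, Y ≠ 0 → ∀ α, pderiv (fun w => u (w, Y)) α z -
      ∑ σ, ∑ β, Γ σ α β * Y β * pderiv (fun Y => u (z, Y)) σ Y = 0)
    {ψ N : Coord s → Coord n} {y : Coord s} (hψ : DifferentiableAt ℝ ψ y)
    (hN : DifferentiableAt ℝ N y) (hψz : ψ y = z) (hNX : N y = X) (i : Fin s) (σ : Fin n) :
    pderiv (fun x => pderiv (fun Y => u (ψ x, Y)) σ (N x)) i y =
      ∑ τ, (pderiv (fun x => N x τ) i y + ∑ α, ∑ β, Γ τ α β * tangentFrame ψ y i α * X β) *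
        pderiv (pderiv (fun Y => u (z, Y)) σ) τ X +
      ∑ τ, ∑ α, Γ τ α σ * tangentFrame ψ y i α * pderiv (fun Y => u (z, Y)) τ X := by
  have hev := eventually_differentiableAt hu
  have hv := contDiffAt_vertical hu
  set D := fderiv ℝ (fderiv ℝ u) (z, X) with hD
  have hsymm : IsSymmSndFDerivAt ℝ u (z, X) :=
    (hu.of_le (m := 2) (by exact WithTop.coe_le_coe.2 le_top)).isSymmSndFDerivAt (by simp)
  -- the derivative along the curve
  have h1 : pderiv (fun x => pderiv (fun Y => u (ψ x, Y)) σ (N x)) i y =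
      D (tangentFrame ψ y i, tangentFrame N y i) (0, coordVec σ) := by
    have hc : HasFDerivAt (fun x => (ψ x, N x)) ((fderiv ℝ ψ y).prod (fderiv ℝ N y)) y :=
      hψ.hasFDerivAt.prodMk hN.hasFDerivAt
    have hpt : (ψ y, N y) = (z, X) := by rw [hψz, hNX]
    have heq : (fun x => pderiv (fun Y => u (ψ x, Y)) σ (N x)) =ᶠ[𝓝 y]
        fun x => fderiv ℝ u (ψ x, N x) (0, coordVec σ) := by
      have := hc.continuousAt.eventually (hpt.symm ▸ hev)
      filter_upwards [this] with x hx
      exact pderiv_vertical hx σ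
    have hcomp := HasFDerivAt.comp (f := fun x => (ψ x, N x)) y
      (hpt.symm ▸ hasFDerivAt_fderiv_apply hu (0, coordVec σ)) hc
    have h' : HasFDerivAt (fun x => fderiv ℝ u (ψ x, N x) (0, coordVec σ)) _ y := hcomp
    rw [pderiv_congr heq, pderiv, h'.fderiv]
    simp [tangentFrame, hψz, hNX, hD]
  -- second vertical derivatives
  have hmk : HasFDerivAt (fun Y : Coord n => (z, Y)) (ContinuousLinearMap.inr ℝ _ _) X :=
    hasFDerivAt_prodMk_right z X
  have hevX : ∀ᶠ Y in 𝓝 X, DifferentiableAt ℝ u (z, Y) := hmk.continuousAt.eventually hev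
  have h2 : D (0, tangentFrame N y i) (0, coordVec σ) =
      ∑ τ, pderiv (fun x => N x τ) i y * pderiv (pderiv (fun Y => u (z, Y)) σ) τ X := by
    have heq : pderiv (fun Y => u (z, Y)) σ =ᶠ[𝓝 X] fun Y => fderiv ℝ u (z, Y) (0, coordVec σ) :=
      hevX.mono fun Y hY => pderiv_vertical hY σ
    have hcomp : HasFDerivAt (fun Y => fderiv ℝ u (z, Y) (0, coordVec σ)) _ X :=
      HasFDerivAt.comp (f := fun Y : Coord n => (z, Y)) X
        (hasFDerivAt_fderiv_apply hu (0, coordVec σ)) hmk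
    have := fderiv_eq_sum_pderiv (pderiv (fun Y => u (z, Y)) σ) X (tangentFrame N y i)
    rw [heq.fderiv_eq, hcomp.fderiv] at this
    simp only [← tangentFrame_apply hN]
    rw [← this]
    simp [hD]
  -- mixed derivatives
  have h3 : ∀ α, D (0, coordVec σ) (coordVec α, 0) =
      ∑ τ, (Γ τ α σ * pderiv (fun Y => u (z, Y)) τ X +
        (∑ β, Γ τ α β * X β) * pderiv (pderiv (fun Y => u (z, Y)) σ) τ X) := by
    intro α
    -- The horizontal condition is known at the single base point z, but for all nonzero Y, so it
    -- may be differentiated in Y at X.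
    have heq : (fun Y => fderiv ℝ u (z, Y) (coordVec α, 0)) =ᶠ[𝓝 X]
        fun Y => ∑ τ, (∑ β, Γ τ α β * Y β) * pderiv (fun Y => u (z, Y)) τ Y := by
      filter_upwards [hevX, isOpen_ne.mem_nhds hX] with Y hY hY0
      have := hh Y hY0 α
      rw [pderiv_base (p := (z, Y)) hY] at this
      simp only [Finset.sum_mul]
      linarith
    have hcomp : HasFDerivAt (fun Y => fderiv ℝ u (z, Y) (coordVec α, 0)) _ X :=
      HasFDerivAt.comp (f := fun Y : Coord n => (z, Y)) X
        (hasFDerivAt_fderiv_apply hu (coordVec α, 0)) hmk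
    have e1 : D (0, coordVec σ) (coordVec α, 0) =
        pderiv (fun Y => fderiv ℝ u (z, Y) (coordVec α, 0)) σ X := by
      rw [pderiv, hcomp.fderiv]
      simp [hD]
    have hdX : ∀ β : Fin n, DifferentiableAt ℝ (fun Y : Coord n => Y β) X := fun β =>
      (contDiffAt_coord (k := ∞) contDiffAt_id β).differentiableAt (by simp)
    have hpX : ∀ β : Fin n, pderiv (fun Y : Coord n => Y β) σ X = if β = σ then 1 else 0 := by
      intro β
      rw [pderiv, show (fun Y : Coord n => Y β) = (EuclideanSpace.proj β : Coord n →L[ℝ] ℝ)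
        from rfl, ContinuousLinearMap.fderiv]
      simp [coordVec]
    rw [e1, pderiv_congr heq, pderiv_sum_mul
      (fun τ _ => DifferentiableAt.fun_sum fun β _ => (hdX β).const_mul _)
      (fun τ _ => (contDiffAt_pderiv hv τ).differentiableAt (by simp))]
    refine Finset.sum_congr rfl fun τ _ => ?_
    rw [pderiv_sum fun β _ => (hdX β).const_mul _, pderiv_pderiv_comm hv]
    have : ∀ β, pderiv (fun Y : Coord n => Γ τ α β * Y β) σ X =
        Γ τ α β * if β = σ then 1 else 0 := by
      intro β
      rw [pderiv_mul (differentiableAt_const _) (hdX β), pderiv_const, hpX]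
      ring
    simp only [this]
    simp
    ring
  have h4 : D (tangentFrame ψ y i, 0) (0, coordVec σ) =
      ∑ α, tangentFrame ψ y i α * D (0, coordVec σ) (coordVec α, 0) := by
    -- The base derivative of a vertical derivative becomes the vertical derivative of a base
    -- derivative, the only order in which the horizontal condition can be used.
    rw [hsymm.eq]
    have hF : tangentFrame ψ y i = ∑ α, tangentFrame ψ y i α • (coordVec α : Coord n) := by
      ext β
      simp [coordVec, Pi.single_apply]
    have hlin : ∀ v : Coord n, D (0, coordVec σ) (v, 0) =
        (D (0, coordVec σ) ∘L ContinuousLinearMap.inl ℝ (Coord n) (Coord n)) v := fun v => by simp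
    rw [hlin]
    conv_lhs => rw [hF]
    simp [map_sum]
  have h5 : D (tangentFrame ψ y i, tangentFrame N y i) =
      D (tangentFrame ψ y i, 0) + D (0, tangentFrame N y i) := by
    rw [← map_add]; simp
  rw [h1, h5, add_apply, h2, h4]
  have s1 : ∑ α, tangentFrame ψ y i α * ∑ τ, Γ τ α σ * pderiv (fun Y => u (z, Y)) τ X =
      ∑ τ, ∑ α, Γ τ α σ * tangentFrame ψ y i α * pderiv (fun Y => u (z, Y)) τ X := by
    simp only [Finset.mul_sum]
    rw [Finset.sum_comm]
    exact Finset.sum_congr rfl fun _ _ => Finset.sum_congr rfl fun _ _ => by ring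
  have s2 : ∑ α, tangentFrame ψ y i α * ∑ τ, (∑ β, Γ τ α β * X β) *
        pderiv (pderiv (fun Y => u (z, Y)) σ) τ X =
      ∑ τ, (∑ α, ∑ β, Γ τ α β * tangentFrame ψ y i α * X β) *
        pderiv (pderiv (fun Y => u (z, Y)) σ) τ X := by
    simp only [Finset.mul_sum, Finset.sum_mul]
    rw [Finset.sum_comm]
    exact Finset.sum_congr rfl fun _ _ => Finset.sum_congr rfl fun _ _ =>
      Finset.sum_congr rfl fun _ _ => by ring
  simp only [h3, add_mul, mul_add, Finset.sum_add_distrib, s1, s2]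
  ring

end VerticalDerivative

/-! ### Traces over the hypersurface -/

section TangentialTrace

variable {s : ℕ} {m : Matrix (Fin (s + 1)) (Fin (s + 1)) ℝ} {F : Fin s → Coord (s + 1)}
  {ν : Coord (s + 1)}

/-- The trace over the hypersurface of a bilinear form annihilated by the normal. -/
theorem tangential_trace (hs : m.IsSymm) (hg : IsUnit (inducedMetric m F).det)
    (hν : pairing m ν ν = 1) (hF : ∀ i, pairing m (F i) ν = 0)
    {B : Fin (s + 1) → Fin (s + 1) → ℝ} (hB : ∀ β, ∑ α, ν α * B α β = 0) :
    ∑ i, ∑ j, (inducedMetric m F)⁻¹ i j * ∑ α, ∑ β, F i α * F j β * B α β =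
      ∑ α, ∑ β, m⁻¹ α β * B α β := by
  -- By completeness, this normal-normal entry is the whole difference between the two traces.
  have h : ∑ α, ∑ β, ν α * ν β * B α β = 0 := by
    rw [Finset.sum_comm]
    refine Finset.sum_eq_zero fun β _ => ?_
    have := congrArg (ν β * ·) (hB β)
    simp only [Finset.mul_sum, mul_zero] at this
    rw [← this]
    exact Finset.sum_congr rfl fun α _ => by ring
  simp only [← frame_completeness hs hg hν hF, add_mul, Finset.sum_add_distrib, h, add_zero,
    Finset.sum_mul, Finset.mul_sum]
  simp only [Finset.sum_comm (s := (Finset.univ : Finset (Fin s)))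
    (t := (Finset.univ : Finset (Fin (s + 1))))]
  exact Finset.sum_congr rfl fun _ _ => Finset.sum_congr rfl fun _ _ =>
    Finset.sum_congr rfl fun _ _ => Finset.sum_congr rfl fun _ _ => by ring

/-- A vector orthogonal to the hypersurface is annihilated by every covector that annihilates the
normal. -/
theorem sum_mul_eq_zero_of_normal (hs : m.IsSymm) (hm : IsUnit m.det)
    (hg : IsUnit (inducedMetric m F).det)
    (hν : pairing m ν ν = 1) (hF : ∀ i, pairing m (F i) ν = 0)
    {c B : Fin (s + 1) → ℝ} (hc : ∑ α, c α * ν α = 0)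
    (hB : ∀ l, ∑ α, ∑ β, m α β * F l α * B β = 0) : ∑ α, c α * B α = 0 := by
  set q : Fin (s + 1) → ℝ := m *ᵥ B with hq
  have hq0 : ∀ l, ∑ α, F l α * q α = 0 := fun l => by
    rw [← hB l]
    simp only [hq, Matrix.mulVec, dotProduct, Finset.mul_sum]
    exact Finset.sum_congr rfl fun _ _ => Finset.sum_congr rfl fun _ _ => by ring
  have hBq : B = m⁻¹ *ᵥ q := by
    rw [hq, Matrix.mulVec_mulVec, Matrix.nonsing_inv_mul _ hm, Matrix.one_mulVec]
  -- The completeness relation expands `B` in the frame and ν; its frame components vanish, leaving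
  -- a multiple of ν.
  have hBν : ∀ α, B α = ν α * ∑ β, ν β * q β := by
    intro α
    rw [hBq]
    simp only [Matrix.mulVec, dotProduct, ← frame_completeness hs hg hν hF, add_mul,
      Finset.sum_add_distrib, Finset.sum_mul, Finset.mul_sum]
    have : ∑ β, ∑ i, ∑ j, (inducedMetric m F)⁻¹ i j * F i α * F j β * q β = 0 := by
      rw [Finset.sum_comm]
      refine Finset.sum_eq_zero fun i _ => ?_
      rw [Finset.sum_comm]
      refine Finset.sum_eq_zero fun j _ => ?_
      have := congrArg ((inducedMetric m F)⁻¹ i j * F i α * ·) (hq0 j)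
      simp only [Finset.mul_sum, mul_zero] at this
      rw [← this]
      exact Finset.sum_congr rfl fun _ _ => by ring
    rw [this, zero_add]
    exact Finset.sum_congr rfl fun _ _ => by ring
  simp only [hBν, ← mul_assoc, ← Finset.sum_mul, hc, zero_mul]

end TangentialTrace

/-! ### Level patches and the geometry of their normal field -/

/-- `ψ` parametrizes, near `y`, a piece of a level hypersurface of `f`, a function with unit
gradient; the metric, the energy density and `f` are smooth near `ψ y`, and the horizontal
derivative of the energy density vanishes at `ψ y`. -/
structure IsLevelPatch {s : ℕ} (G : Coord (s + 1) → Matrix (Fin (s + 1)) (Fin (s + 1)) ℝ)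
    (γ : Coord (s + 1) → Coord (s + 1) → ℝ) (f : Coord (s + 1) → ℝ)
    (ψ : Coord s → Coord (s + 1)) (y : Coord s) : Prop where
  metric : ∀ α β, ContDiffAt ℝ ∞ (fun w => G w α β) (ψ y)
  posDef : ∀ᶠ w in 𝓝 (ψ y), (G w).PosDef
  energy : ∀ X, X ≠ 0 → ContDiffAt ℝ ∞
    (fun p : Coord (s + 1) × Coord (s + 1) => γ p.1 (direction (G p.1) p.2)) (ψ y, X)
  horizontal : ∀ X : Coord (s + 1), X ≠ 0 → ∀ α,
    pderiv (fun w => γ w (direction (G w) X)) α (ψ y) - ∑ σ, ∑ β,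
      christoffel G (ψ y) σ α β * X β *
        pderiv (fun Y => γ (ψ y) (direction (G (ψ y)) Y)) σ X = 0
  levelFun : ContDiffAt ℝ ∞ f (ψ y)
  unit : ∀ᶠ w in 𝓝 (ψ y), ∑ α, pderiv f α w * raiseIndex (G w) (fun α => pderiv f α w) α = 1
  param : ContDiffAt ℝ ∞ ψ y
  immersive : Function.Injective (fderiv ℝ ψ y)
  level : ∀ᶠ x in 𝓝 y, f (ψ x) = f (ψ y)

/-- The unit normal field `ν^α = m^{αβ} ∂_β f`. -/
def normalField {n : ℕ} (G : Coord n → Matrix (Fin n) (Fin n) ℝ) (f : Coord n → ℝ)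
    (w : Coord n) : Coord n :=
  raiseIndex (G w) fun α => pderiv f α w

/-- The induced metric along a parametrization. -/
def metricAlong {s n : ℕ} (G : Coord n → Matrix (Fin n) (Fin n) ℝ) (ψ : Coord s → Coord n)
    (x : Coord s) : Matrix (Fin s) (Fin s) ℝ :=
  inducedMetric (G (ψ x)) (tangentFrame ψ x)

/-- The derivative of the energy density in the direction of the `k`-th frame vector. -/
def energyCovector {s n : ℕ} (G : Coord n → Matrix (Fin n) (Fin n) ℝ)
    (γ : Coord n → Coord n → ℝ) (f : Coord n → ℝ) (ψ : Coord s → Coord n) (x : Coord s)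
    (k : Fin s) : ℝ :=
  ∑ σ, tangentFrame ψ x k σ *
    pderiv (fun Y => γ (ψ x) (direction (G (ψ x)) Y)) σ (normalField G f (ψ x))

/-- The tangential gradient of the energy density. -/
def energyVector {s n : ℕ} (G : Coord n → Matrix (Fin n) (Fin n) ℝ)
    (γ : Coord n → Coord n → ℝ) (f : Coord n → ℝ) (ψ : Coord s → Coord n) (x : Coord s)
    (j : Fin s) : ℝ :=
  ∑ k, (metricAlong G ψ x)⁻¹ k j * energyCovector G γ f ψ x k

namespace IsLevelPatch

variable {s : ℕ} {G : Coord (s + 1) → Matrix (Fin (s + 1)) (Fin (s + 1)) ℝ}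
  {γ : Coord (s + 1) → Coord (s + 1) → ℝ} {f : Coord (s + 1) → ℝ}
  {ψ : Coord s → Coord (s + 1)} {y : Coord s} (h : IsLevelPatch G γ f ψ y)

include h

theorem symm : ∀ᶠ w in 𝓝 (ψ y), (G w).IsSymm :=
  h.posDef.mono fun _ hw => by simpa using hw.1

theorem isUnit_det : ∀ᶠ w in 𝓝 (ψ y), IsUnit (G w).det :=
  h.posDef.mono fun _ hw => hw.det_pos.ne'.isUnit

theorem differentiableAt_metric (i j : Fin (s + 1)) :
    DifferentiableAt ℝ (fun w => G w i j) (ψ y) := (h.metric i j).differentiableAt (by simp)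

theorem differentiableAt_param : DifferentiableAt ℝ ψ y := h.param.differentiableAt (by simp)

theorem contDiffAt_normalField : ContDiffAt ℝ ∞ (normalField G f) (ψ y) :=
  contDiffAt_raiseIndex h.metric h.isUnit_det.self_of_nhds fun α => contDiffAt_pderiv h.levelFun α

theorem contDiffAt_metricAlong (i j : Fin s) :
    ContDiffAt ℝ ∞ (fun x => metricAlong G ψ x i j) y :=
  contDiffAt_pairing (fun α β => ContDiffAt.comp y (h.metric α β) h.param)
    (contDiffAt_tangentFrame h.param i) (contDiffAt_tangentFrame h.param j)

theorem linearIndependent : LinearIndependent ℝ (tangentFrame ψ y) := by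
  have hb : LinearIndependent ℝ (fun i : Fin s => (coordVec i : Coord s)) := by
    have hv : (fun i : Fin s => (coordVec i : Coord s)) =
        (EuclideanSpace.basisFun (Fin s) ℝ).toBasis := by
      ext i : 1
      simp [coordVec]
    rw [hv]
    exact (EuclideanSpace.basisFun (Fin s) ℝ).toBasis.linearIndependent
  exact hb.map' (fderiv ℝ ψ y).toLinearMap (LinearMap.ker_eq_bot.2 h.immersive)

/-- Immersivity is assumed at `y` only; nondegeneracy spreads to a neighbourhood by continuity of
the determinant. -/
theorem isUnit_det_metricAlong : ∀ᶠ x in 𝓝 y, IsUnit (metricAlong G ψ x).det := by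
  have h0 : (metricAlong G ψ y).det ≠ 0 :=
    (inducedMetric_posDef h.posDef.self_of_nhds h.linearIndependent).det_pos.ne'
  exact ((contDiffAt_det h.contDiffAt_metricAlong).continuousAt.eventually_ne h0).mono
    fun _ hx => hx.isUnit

theorem symm_metricAlong : ∀ᶠ x in 𝓝 y, (metricAlong G ψ x).IsSymm :=
  (h.param.continuousAt.eventually h.symm).mono fun _ hx => inducedMetric_isSymm hx _

/-- The frame is annihilated by the differential of the level-set function. -/
theorem frame_orthogonal : ∀ᶠ x in 𝓝 y, ∀ j, ∑ α, pderiv f α (ψ x) * tangentFrame ψ x j α = 0 := by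
  filter_upwards [h.level.eventually_nhds, eventually_differentiableAt h.param,
    h.param.continuousAt.eventually (eventually_differentiableAt h.levelFun)] with x h1 h2 h3 j
  rw [← pderiv_const (f (ψ y)) j x, ← pderiv_congr h1, pderiv_comp h3 h2]
  exact Finset.sum_congr rfl fun _ _ => mul_comm _ _

theorem normalField_lower : ∀ᶠ w in 𝓝 (ψ y), ∀ k,
    pderiv f k w = ∑ j, G w k j * normalField G f w j :=
  h.isUnit_det.mono fun w hw k => (sum_mul_raiseIndex hw (fun α => pderiv f α w) k).symm

theorem normalField_ne_zero : ∀ᶠ w in 𝓝 (ψ y), normalField G f w ≠ 0 := by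
  filter_upwards [h.unit] with w hw h0
  rw [normalField] at h0
  simp [h0] at hw

theorem pairing_normalField : pairing (G (ψ y)) (normalField G f (ψ y)) (normalField G f (ψ y))
    = 1 := by
  rw [normalField, pairing_raiseIndex h.isUnit_det.self_of_nhds, h.unit.self_of_nhds]

theorem pairing_frame_normalField (i : Fin s) :
    pairing (G (ψ y)) (tangentFrame ψ y i) (normalField G f (ψ y)) = 0 := by
  rw [normalField, pairing_raiseIndex h.isUnit_det.self_of_nhds, h.frame_orthogonal.self_of_nhds]

/-- The covariant derivative of the normal. -/
theorem lower_covDeriv_normalField (α β : Fin (s + 1)) :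
    ∑ j, G (ψ y) β j * covDeriv G (fun w => normalField G f w) (ψ y) α j =
      covHessian G f (ψ y) α β :=
  (covDeriv_lower h.differentiableAt_metric h.isUnit_det.self_of_nhds h.symm
    (fun j => (contDiffAt_coord h.contDiffAt_normalField j).differentiableAt (by simp))
    h.normalField_lower α β).symm

theorem covHessian_symm (α β : Fin (s + 1)) :
    covHessian G f (ψ y) α β = covHessian G f (ψ y) β α := by
  have := pderiv_pderiv_comm h.levelFun α β
  simp only [covHessian, christoffel_symm h.symm _ α β]
  exact congrArg (· - _) this

/-- The unit-gradient condition is differentiated here, which is why it is needed on an open set and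
not just on the hypersurface. -/
theorem sum_pderiv_mul_covDeriv (α : Fin (s + 1)) :
    ∑ τ, pderiv f τ (ψ y) * covDeriv G (fun w => normalField G f w) (ψ y) α τ = 0 :=
  sum_mul_covDeriv_eq_zero (c := fun w τ => pderiv f τ w)
    h.differentiableAt_metric h.isUnit_det.self_of_nhds h.symm
    (fun j => (contDiffAt_coord h.contDiffAt_normalField j).differentiableAt (by simp))
    (fun j => (contDiffAt_pderiv h.levelFun j).differentiableAt (by simp))
    h.normalField_lower h.unit α

/-- Symmetry of the Hessian exchanges its slots, and Hess(β, ν) is df paired with ∇_β ν, which is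
zero. -/
theorem covHessian_normal (β : Fin (s + 1)) :
    ∑ α, normalField G f (ψ y) α * covHessian G f (ψ y) α β = 0 := by
  rw [← h.sum_pderiv_mul_covDeriv β]
  simp only [h.covHessian_symm _ β, ← h.lower_covDeriv_normalField,
    h.normalField_lower.self_of_nhds, Finset.mul_sum, Finset.sum_mul]
  rw [Finset.sum_comm]
  refine Finset.sum_congr rfl fun a _ => Finset.sum_congr rfl fun b _ => ?_
  rw [h.symm.self_of_nhds.apply]
  ring

theorem covDeriv_eq (α τ : Fin (s + 1)) :
    covDeriv G (fun w => normalField G f w) (ψ y) α τ =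
      ∑ β, (G (ψ y))⁻¹ τ β * covHessian G f (ψ y) α β := by
  have : (G (ψ y))⁻¹ *ᵥ (G (ψ y) *ᵥ covDeriv G (fun w => normalField G f w) (ψ y) α) =
      covDeriv G (fun w => normalField G f w) (ψ y) α := by
    rw [Matrix.mulVec_mulVec, Matrix.nonsing_inv_mul _ h.isUnit_det.self_of_nhds,
      Matrix.one_mulVec]
  conv_lhs => rw [← this]
  simp only [Matrix.mulVec, dotProduct, h.lower_covDeriv_normalField]

/-- Raising the free index in `covHessian_normal`: the integral curves of ν are geodesics. -/
theorem covDeriv_normal (τ : Fin (s + 1)) :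
    ∑ α, normalField G f (ψ y) α * covDeriv G (fun w => normalField G f w) (ψ y) α τ = 0 := by
  simp only [h.covDeriv_eq, Finset.mul_sum]
  rw [Finset.sum_comm]
  refine Finset.sum_eq_zero fun β _ => ?_
  have := congrArg ((G (ψ y))⁻¹ τ β * ·) (h.covHessian_normal β)
  simp only [Finset.mul_sum, mul_zero] at this
  rw [← this]
  exact Finset.sum_congr rfl fun _ _ => by ring

end IsLevelPatch

/-! ### Divergence of the tangential energy gradient -/

namespace IsLevelPatch

variable {s : ℕ} {G : Coord (s + 1) → Matrix (Fin (s + 1)) (Fin (s + 1)) ℝ}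
  {γ : Coord (s + 1) → Coord (s + 1) → ℝ} {f : Coord (s + 1) → ℝ}
  {ψ : Coord s → Coord (s + 1)} {y : Coord s} (h : IsLevelPatch G γ f ψ y)

include h

/-- The hypotheses of `stress_eq` are needed at all points near `y`, since its formula is going to
be differentiated. -/
theorem eventually_isLevelFrame : ∀ᶠ x in 𝓝 y, IsUnit (metricAlong G ψ x).det ∧
    (∀ j, ∑ α, pderiv f α (ψ x) * tangentFrame ψ x j α = 0) ∧
    DifferentiableAt ℝ (fun Y => γ (ψ x) (direction (G (ψ x)) Y)) (normalField G f (ψ x)) := by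
  have hc : ContinuousAt (fun x => (ψ x, normalField G f (ψ x))) y :=
    h.param.continuousAt.prodMk
      (ContinuousAt.comp (f := ψ) h.contDiffAt_normalField.continuousAt h.param.continuousAt)
  filter_upwards [h.isUnit_det_metricAlong, h.frame_orthogonal,
    hc.eventually (eventually_differentiableAt (h.energy _ h.normalField_ne_zero.self_of_nhds))]
    with x h1 h2 h3
  exact ⟨h1, h2, DifferentiableAt.comp
    (f := fun Y : Coord (s + 1) => (ψ x, Y)) (normalField G f (ψ x)) h3
    (hasFDerivAt_prodMk_right _ _).differentiableAt⟩

theorem contDiffAt_energyVertical (σ : Fin (s + 1)) :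
    ContDiffAt ℝ ∞ (fun x => pderiv (fun Y => γ (ψ x) (direction (G (ψ x)) Y)) σ
      (normalField G f (ψ x))) y := by
  have hu := h.energy _ h.normalField_ne_zero.self_of_nhds
  have hc : ContDiffAt ℝ ∞ (fun x => (ψ x, normalField G f (ψ x))) y :=
    h.param.prodMk (ContDiffAt.comp (g := normalField G f) (f := ψ) y h.contDiffAt_normalField h.param)
  have h1 := ContDiffAt.comp (f := fun x => (ψ x, normalField G f (ψ x))) y
    ((hu.fderiv_right (m := ∞) (by simp)).clm_apply
      (contDiffAt_const (c := ((0 : Coord (s + 1)), coordVec σ)))) hc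
  refine h1.congr_of_eventuallyEq ?_
  filter_upwards [hc.continuousAt.eventually (eventually_differentiableAt hu)] with x hx
  exact pderiv_vertical hx σ

theorem contDiffAt_energyCovector (k : Fin s) :
    ContDiffAt ℝ ∞ (fun x => energyCovector G γ f ψ x k) y :=
  ContDiffAt.sum fun σ _ => (contDiffAt_tangentFrame_coord h.param k σ).mul
    (h.contDiffAt_energyVertical σ)

theorem contDiffAt_energyVector (j : Fin s) :
    ContDiffAt ℝ ∞ (fun x => energyVector G γ f ψ x j) y :=
  ContDiffAt.sum fun k _ => (contDiffAt_inv_apply h.contDiffAt_metricAlong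
    h.isUnit_det_metricAlong.self_of_nhds k j).mul (h.contDiffAt_energyCovector k)

theorem contDiffAt_energyAlong :
    ContDiffAt ℝ ∞ (fun x => γ (ψ x) (direction (G (ψ x)) (normalField G f (ψ x)))) y :=
  ContDiffAt.comp (f := fun x => (ψ x, normalField G f (ψ x))) y
    (h.energy _ h.normalField_ne_zero.self_of_nhds)
    (h.param.prodMk (ContDiffAt.comp (g := normalField G f) (f := ψ) y h.contDiffAt_normalField h.param))

theorem energyVector_lower : ∀ᶠ x in 𝓝 y, ∀ k,
    energyCovector G γ f ψ x k = ∑ j, metricAlong G ψ x k j * energyVector G γ f ψ x j := by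
  filter_upwards [h.isUnit_det_metricAlong, h.symm_metricAlong] with x hx hs k
  have := congrFun (show metricAlong G ψ x *ᵥ ((metricAlong G ψ x)⁻¹ *ᵥ
      energyCovector G γ f ψ x) = energyCovector G γ f ψ x by
    rw [Matrix.mulVec_mulVec, Matrix.mul_nonsing_inv _ hx, Matrix.one_mulVec]) k
  rw [← this]
  simp only [Matrix.mulVec, dotProduct, energyVector]
  refine Finset.sum_congr rfl fun j _ => congrArg _ (Finset.sum_congr rfl fun i _ => ?_)
  rw [hs.inv.apply]

/-- `∂_i (ν∘ψ) + Γ(F_i, ν) = F_i^κ ∇_κ ν`. -/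
theorem covDeriv_normal_along (i : Fin s) (τ : Fin (s + 1)) :
    pderiv (fun x => normalField G f (ψ x) τ) i y + ∑ α, ∑ β, christoffel G (ψ y) τ α β *
      tangentFrame ψ y i α * normalField G f (ψ y) β =
      ∑ κ, tangentFrame ψ y i κ * covDeriv G (fun w => normalField G f w) (ψ y) κ τ := by
  rw [pderiv_comp (f := fun w => normalField G f w τ)
    ((contDiffAt_coord h.contDiffAt_normalField τ).differentiableAt (by simp))
    h.differentiableAt_param]
  simp only [covDeriv, mul_add, Finset.sum_add_distrib, Finset.mul_sum]
  congr 1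
  exact Finset.sum_congr rfl fun _ _ => Finset.sum_congr rfl fun _ _ => by ring

theorem radial_derivative : ∑ σ, pderiv (fun Y => γ (ψ y) (direction (G (ψ y)) Y)) σ
    (normalField G f (ψ y)) * normalField G f (ψ y) σ = 0 := by
  rw [← fderiv_direction_self (G (ψ y)) (γ (ψ y)) h.eventually_isLevelFrame.self_of_nhds.2.2,
    fderiv_eq_sum_pderiv]
  exact Finset.sum_congr rfl fun _ _ => mul_comm _ _

/-- The covariant derivative of the tangential differential of the energy density. -/
theorem covDeriv_energyCovector (i k : Fin s) :
    pderiv (fun x => energyCovector G γ f ψ x k) i y -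
      ∑ l, christoffel (metricAlong G ψ) y l i k * energyCovector G γ f ψ y l =
    ∑ κ, ∑ σ, tangentFrame ψ y i κ * tangentFrame ψ y k σ *
      ∑ τ, covDeriv G (fun w => normalField G f w) (ψ y) κ τ *
        pderiv (pderiv (fun Y => γ (ψ y) (direction (G (ψ y)) Y)) σ) τ
          (normalField G f (ψ y)) := by
  set γ₁ := fun σ => pderiv (fun Y => γ (ψ y) (direction (G (ψ y)) Y)) σ (normalField G f (ψ y))
    with hγ₁
  have hν0 := h.normalField_ne_zero.self_of_nhds
  have hN : DifferentiableAt ℝ (fun x => normalField G f (ψ x)) y :=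
    (ContDiffAt.comp (g := normalField G f) (f := ψ) y h.contDiffAt_normalField h.param).differentiableAt (by simp)
  have hD := fun σ => pderiv_vertical_along (σ := σ) (i := i) hν0 (h.energy _ hν0) h.horizontal
    h.differentiableAt_param hN rfl rfl
  have h1 : pderiv (fun x => energyCovector G γ f ψ x k) i y = _ :=
    pderiv_sum_mul (fun σ _ => (contDiffAt_tangentFrame_coord h.param k σ).differentiableAt
      (by simp)) (fun σ _ => (h.contDiffAt_energyVertical σ).differentiableAt (by simp)) i
  simp only [h.covDeriv_normal_along] at hD
  rw [h1]
  simp only [hD]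
  -- By the Gauss formula the covariant derivative of the frame is a multiple of ν, and the vertical
  -- differential of the energy annihilates ν; so differentiating the frame contributes nothing.
  have hg := sum_mul_eq_zero_of_normal h.symm.self_of_nhds h.isUnit_det.self_of_nhds
    h.isUnit_det_metricAlong.self_of_nhds h.pairing_normalField h.pairing_frame_normalField
    h.radial_derivative fun l => gauss_formula h.param h.differentiableAt_metric
      h.isUnit_det.self_of_nhds h.symm h.isUnit_det_metricAlong.self_of_nhds i k l
  change ∑ σ, γ₁ σ * (frameDeriv G ψ y i k σ - ∑ l, christoffel (metricAlong G ψ) y l i k *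
    tangentFrame ψ y l σ) = 0 at hg
  simp only [frameDeriv, mul_sub, mul_add, Finset.sum_sub_distrib, Finset.sum_add_distrib] at hg
  have s1 : ∑ l, christoffel (metricAlong G ψ) y l i k * energyCovector G γ f ψ y l =
      ∑ σ, γ₁ σ * ∑ l, christoffel (metricAlong G ψ) y l i k * tangentFrame ψ y l σ := by
    simp only [energyCovector, Finset.mul_sum]
    rw [Finset.sum_comm]
    exact Finset.sum_congr rfl fun _ _ => Finset.sum_congr rfl fun _ _ => by rw [hγ₁]; ring
  -- The Christoffel term left by the horizontal condition is exactly the connection part of ∇_i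
  -- F_k.
  have s2 : ∑ σ, tangentFrame ψ y k σ * ∑ τ, ∑ α, christoffel G (ψ y) τ α σ *
      tangentFrame ψ y i α * γ₁ τ = ∑ τ, γ₁ τ * ∑ α, ∑ β, christoffel G (ψ y) τ α β *
        tangentFrame ψ y i α * tangentFrame ψ y k β := by
    simp only [Finset.mul_sum]
    rw [Finset.sum_comm]
    refine Finset.sum_congr rfl fun _ _ => ?_
    rw [Finset.sum_comm]
    exact Finset.sum_congr rfl fun _ _ => Finset.sum_congr rfl fun _ _ => by ring
  have s3 : ∑ σ, tangentFrame ψ y k σ * ∑ τ, (∑ κ, tangentFrame ψ y i κ *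
        covDeriv G (fun w => normalField G f w) (ψ y) κ τ) *
        pderiv (pderiv (fun Y => γ (ψ y) (direction (G (ψ y)) Y)) σ) τ (normalField G f (ψ y)) =
      ∑ κ, ∑ σ, tangentFrame ψ y i κ * tangentFrame ψ y k σ *
      ∑ τ, covDeriv G (fun w => normalField G f w) (ψ y) κ τ *
        pderiv (pderiv (fun Y => γ (ψ y) (direction (G (ψ y)) Y)) σ) τ
          (normalField G f (ψ y)) := by
    simp only [Finset.mul_sum, Finset.sum_mul]
    rw [Finset.sum_comm]
    conv_lhs => enter [2, τ]; rw [Finset.sum_comm]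
    rw [Finset.sum_comm]
    refine Finset.sum_congr rfl fun _ _ => ?_
    rw [Finset.sum_comm]
    exact Finset.sum_congr rfl fun _ _ => Finset.sum_congr rfl fun _ _ => by ring
  simp only [mul_add, Finset.sum_add_distrib]
  rw [s1, s3]
  rw [← hγ₁] at *
  rw [s2]
  linarith

/-- The divergence of the tangential gradient of the energy density. -/
theorem divergence_energyVector :
    ∑ i, covDeriv (metricAlong G ψ) (energyVector G γ f ψ) y i i =
      ∑ α, ∑ β, fderiv ℝ (fun ξ' => fderiv ℝ (gradientEnergy (G (ψ y)) (γ (ψ y))) ξ'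
        (Pi.single α 1)) (fun α => pderiv f α (ψ y)) (Pi.single β 1) *
        covHessian G f (ψ y) α β := by
  have hν0 := h.normalField_ne_zero.self_of_nhds
  rw [divergence_eq (c := energyCovector G γ f ψ)
    (fun i j => (h.contDiffAt_metricAlong i j).differentiableAt (by simp))
    h.isUnit_det_metricAlong.self_of_nhds h.symm_metricAlong
    (fun j => (h.contDiffAt_energyVector j).differentiableAt (by simp)) h.energyVector_lower]
  simp only [h.covDeriv_energyCovector]
  set B : Fin (s + 1) → Fin (s + 1) → ℝ := fun κ σ =>
    ∑ τ, covDeriv G (fun w => normalField G f w) (ψ y) κ τ *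
        pderiv (pderiv (fun Y => γ (ψ y) (direction (G (ψ y)) Y)) σ) τ
          (normalField G f (ψ y)) with hB
  -- Since ∇_ν ν = 0, `B` has no normal part in its first slot, so the induced trace may be replaced
  -- by the ambient one.
  have hB0 : ∀ β, ∑ α, normalField G f (ψ y) α * B α β = 0 := by
    intro β
    simp only [hB, Finset.mul_sum]
    rw [Finset.sum_comm]
    refine Finset.sum_eq_zero fun τ _ => ?_
    simp only [← mul_assoc, ← Finset.sum_mul, h.covDeriv_normal, zero_mul]
  have := tangential_trace h.symm.self_of_nhds h.isUnit_det_metricAlong.self_of_nhds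
    h.pairing_normalField h.pairing_frame_normalField hB0
  refine Eq.trans this (Finset.sum_congr rfl fun α _ => ?_)
  have hc : ContDiffAt ℝ ∞ (fun Y => γ (ψ y) (direction (G (ψ y)) Y))
      (raiseIndex (G (ψ y)) fun α => pderiv f α (ψ y)) :=
    contDiffAt_vertical (h.energy _ hν0)
  have hd := fun β => fderiv_fderiv_gradientEnergy (m := G (ψ y)) (γ := γ (ψ y)) hc α β
  simp only [hd, hB, h.covDeriv_eq, Finset.mul_sum, Finset.sum_mul]
  conv_rhs => rw [Finset.sum_comm]
  refine Finset.sum_congr rfl fun σ _ => ?_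
  conv_rhs => rw [Finset.sum_comm]
  refine Finset.sum_congr rfl fun τ _ => Finset.sum_congr rfl fun ρ _ => ?_
  rw [h.symm.self_of_nhds.inv.apply σ α]
  simp only [normalField]
  ring

end IsLevelPatch

/-! ### The stress on a level patch and the normal component of A -/

/-- The stress along a parametrized piece of a level hypersurface of `f`. -/
def stressAlong {s n : ℕ} (G : Coord n → Matrix (Fin n) (Fin n) ℝ)
    (γ : Coord n → Coord n → ℝ) (f : Coord n → ℝ) (ψ : Coord s → Coord n) (x : Coord s)
    (i : Fin s) (β : Fin n) : ℝ :=
  stress (G (ψ x)) (γ (ψ x)) (fun α' => pderiv f α' (ψ x)) (tangentFrame ψ x) i β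

namespace IsLevelPatch

variable {s : ℕ} {G : Coord (s + 1) → Matrix (Fin (s + 1)) (Fin (s + 1)) ℝ}
  {γ : Coord (s + 1) → Coord (s + 1) → ℝ} {f : Coord (s + 1) → ℝ}
  {ψ : Coord s → Coord (s + 1)} {y : Coord s} (h : IsLevelPatch G γ f ψ y)

include h

/-- Splits the stress into a part along the conormal and a part tangent to the surface. In this form
its smoothness along the patch is visible, which the derivative in the frame variable hides. -/
theorem stressAlong_eq : ∀ᶠ x in 𝓝 y, ∀ i β, stressAlong G γ f ψ x i β =
    - (pderiv f β (ψ x) * energyVector G γ f ψ x i) +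
      γ (ψ x) (direction (G (ψ x)) (normalField G f (ψ x))) *
        ∑ q, ∑ σ, (metricAlong G ψ x)⁻¹ i q * G (ψ x) σ β * tangentFrame ψ x q σ := by
  filter_upwards [h.eventually_isLevelFrame] with x ⟨h1, h2, h3⟩ i β
  rw [stressAlong, stress_eq h1 h2 h3]
  simp only [fderiv_eq_sum_pderiv _ (raiseIndex _ _), ← Finset.mul_sum]
  rfl

theorem contDiffAt_stressAlong (i : Fin s) (β : Fin (s + 1)) :
    ContDiffAt ℝ ∞ (fun x => stressAlong G γ f ψ x i β) y := by
  refine ContDiffAt.congr_of_eventuallyEq ?_ (h.stressAlong_eq.mono fun x hx => hx i β)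
  refine ((ContDiffAt.comp (g := pderiv f β) (f := ψ) y (contDiffAt_pderiv h.levelFun β)
    h.param).mul (h.contDiffAt_energyVector i)).neg.add (h.contDiffAt_energyAlong.mul ?_)
  exact ContDiffAt.sum fun q _ => ContDiffAt.sum fun σ _ =>
    ((contDiffAt_inv_apply h.contDiffAt_metricAlong h.isUnit_det_metricAlong.self_of_nhds i q).mul
      (ContDiffAt.comp (g := fun w => G w σ β) (f := ψ) y (h.metric σ β) h.param)).mul
      (contDiffAt_tangentFrame_coord h.param q σ)

/-- The normal component of the stress is minus the tangential gradient of the energy density. -/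
theorem sum_normal_mul_stressAlong : ∀ᶠ x in 𝓝 y, ∀ i,
    ∑ β, normalField G f (ψ x) β * stressAlong G γ f ψ x i β = - energyVector G γ f ψ x i := by
  filter_upwards [h.stressAlong_eq, h.frame_orthogonal, h.param.continuousAt.eventually h.unit,
    h.param.continuousAt.eventually h.normalField_lower] with x h1 h2 h3 h4 i
  have e1 : ∑ β, normalField G f (ψ x) β * (pderiv f β (ψ x) * energyVector G γ f ψ x i) =
      energyVector G γ f ψ x i := by
    change ∑ β, pderiv f β (ψ x) * normalField G f (ψ x) β = 1 at h3
    trans (∑ β, pderiv f β (ψ x) * normalField G f (ψ x) β) * energyVector G γ f ψ x i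
    · rw [Finset.sum_mul]
      exact Finset.sum_congr rfl fun _ _ => by ring
    · rw [h3, one_mul]
  have e2 : ∑ β, normalField G f (ψ x) β * (γ (ψ x) (direction (G (ψ x))
      (normalField G f (ψ x))) * ∑ q, ∑ σ, (metricAlong G ψ x)⁻¹ i q * G (ψ x) σ β *
        tangentFrame ψ x q σ) = 0 := by
    have : ∑ β, normalField G f (ψ x) β * ∑ q, ∑ σ, (metricAlong G ψ x)⁻¹ i q * G (ψ x) σ β *
        tangentFrame ψ x q σ = ∑ q, (metricAlong G ψ x)⁻¹ i q *
          ∑ α, pderiv f α (ψ x) * tangentFrame ψ x q α := by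
      simp only [h4, Finset.mul_sum, Finset.sum_mul]
      rw [Finset.sum_comm]
      refine Finset.sum_congr rfl fun _ _ => ?_
      rw [Finset.sum_comm]
      exact Finset.sum_congr rfl fun _ _ => Finset.sum_congr rfl fun _ _ => by ring
    simp only [h2, mul_zero, Finset.sum_const_zero] at this
    have := congrArg (γ (ψ x) (direction (G (ψ x)) (normalField G f (ψ x))) * ·) this
    simp only [mul_zero, Finset.mul_sum] at this ⊢
    rw [← this]
    exact Finset.sum_congr rfl fun _ _ => Finset.sum_congr rfl fun _ _ =>
      Finset.sum_congr rfl fun _ _ => by ring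
  simp only [h1, mul_add, mul_neg, Finset.sum_add_distrib, Finset.sum_neg_distrib, e1, e2,
    add_zero]

/-- The contraction of the stress with the covariant derivative of the normal. -/
theorem sum_stressAlong_mul_covDeriv :
    ∑ i, ∑ τ, stressAlong G γ f ψ y i τ * ∑ κ, tangentFrame ψ y i κ *
      covDeriv G (fun w => normalField G f w) (ψ y) κ τ =
    γ (ψ y) (direction (G (ψ y)) (normalField G f (ψ y))) *
      ∑ α, ∑ β, (G (ψ y))⁻¹ α β * covHessian G f (ψ y) α β := by
  have htr := tangential_trace h.symm.self_of_nhds h.isUnit_det_metricAlong.self_of_nhds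
    h.pairing_normalField h.pairing_frame_normalField h.covHessian_normal
  rw [← htr, Finset.mul_sum]
  refine Finset.sum_congr rfl fun i _ => ?_
  simp only [h.stressAlong_eq.self_of_nhds]
  set γ₀ := γ (ψ y) (direction (G (ψ y)) (normalField G f (ψ y)))
  set D := covDeriv G (fun w => normalField G f w) (ψ y) with hD
  -- The conormal part of the stress does not contribute, because ∇ν is orthogonal to ν.
  have e1 : ∑ τ, pderiv f τ (ψ y) * energyVector G γ f ψ y i *
      ∑ κ, tangentFrame ψ y i κ * D κ τ = 0 := by
    have : ∑ κ, energyVector G γ f ψ y i * tangentFrame ψ y i κ *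
        ∑ τ, pderiv f τ (ψ y) * D κ τ = 0 := by
      simp only [hD, h.sum_pderiv_mul_covDeriv, mul_zero, Finset.sum_const_zero]
    rw [← this]
    simp only [Finset.mul_sum]
    rw [Finset.sum_comm]
    exact Finset.sum_congr rfl fun _ _ => Finset.sum_congr rfl fun _ _ => by ring
  simp only [add_mul, neg_mul, Finset.sum_add_distrib, Finset.sum_neg_distrib, e1, neg_zero,
    zero_add]
  simp only [← h.lower_covDeriv_normalField, ← hD, Finset.mul_sum, Finset.sum_mul]
  rw [Finset.sum_comm]
  conv_lhs => enter [2, κ]; rw [Finset.sum_comm]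
  rw [Finset.sum_comm]
  refine Finset.sum_congr rfl fun q _ => Finset.sum_congr rfl fun κ _ => ?_
  rw [Finset.sum_comm]
  exact Finset.sum_congr rfl fun _ _ => Finset.sum_congr rfl fun _ _ => by
    simp only [metricAlong]; ring

/-- The normal component of the driving vector of a level hypersurface. -/
theorem sum_drivingCoord_mul_pderiv :
    ∑ α, drivingCoord G γ f ψ y α * pderiv f α (ψ y) =
      -∑ α, ∑ β, diffusionTensor (G (ψ y)) (γ (ψ y)) (fun α' => pderiv f α' (ψ y)) α β *
        covHessian G f (ψ y) α β := by
  set R : Fin s → Fin (s + 1) → ℝ := fun i β =>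
    pderiv (fun x => stressAlong G γ f ψ x i β) i y
      + ∑ j, christoffel (metricAlong G ψ) y i i j * stressAlong G γ f ψ y j β
      - ∑ κ, ∑ τ, christoffel G (ψ y) τ κ β * tangentFrame ψ y i κ * stressAlong G γ f ψ y i τ
    with hR
  -- The inverse metric in A raises df to ν, so only the contraction of ν with the divergence `R` of
  -- the stress matters.
  have h0 : ∑ α, drivingCoord G γ f ψ y α * pderiv f α (ψ y) =
      ∑ i, ∑ β, normalField G f (ψ y) β * R i β := by
    have hA : ∀ α, drivingCoord G γ f ψ y α = ∑ β, (G (ψ y))⁻¹ α β * ∑ i, R i β :=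
      fun α => rfl
    have hN : ∀ β, normalField G f (ψ y) β = ∑ α, (G (ψ y))⁻¹ β α * pderiv f α (ψ y) :=
      fun β => rfl
    simp only [hA, hN, Finset.mul_sum, Finset.sum_mul]
    rw [Finset.sum_comm]
    conv_lhs => enter [2, β]; rw [Finset.sum_comm]
    rw [Finset.sum_comm]
    refine Finset.sum_congr rfl fun i _ => Finset.sum_congr rfl fun β _ =>
      Finset.sum_congr rfl fun α _ => ?_
    rw [h.symm.self_of_nhds.inv.apply β α]
    ring
  have h1 : ∀ i, ∑ β, normalField G f (ψ y) β * pderiv (fun x => stressAlong G γ f ψ x i β) i y =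
      - pderiv (fun x => energyVector G γ f ψ x i) i y - ∑ β, stressAlong G γ f ψ y i β *
        pderiv (fun x => normalField G f (ψ x) β) i y := by
    intro i
    have hN : ∀ β, DifferentiableAt ℝ (fun x => normalField G f (ψ x) β) y := fun β =>
      (contDiffAt_coord (ContDiffAt.comp (g := normalField G f) (f := ψ) y
        h.contDiffAt_normalField h.param) β).differentiableAt (by simp)
    have := pderiv_sum_mul (u := Finset.univ) (fun β _ => hN β)
      (fun β _ => (h.contDiffAt_stressAlong i β).differentiableAt (by simp)) i
    rw [pderiv_congr (h.sum_normal_mul_stressAlong.mono fun x hx => hx i), pderiv_neg,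
      Finset.sum_add_distrib] at this
    linarith
  have h2 : ∀ i, ∑ β, normalField G f (ψ y) β *
      ∑ j, christoffel (metricAlong G ψ) y i i j * stressAlong G γ f ψ y j β =
      - ∑ j, christoffel (metricAlong G ψ) y i i j * energyVector G γ f ψ y j := by
    intro i
    rw [← Finset.sum_neg_distrib]
    simp only [← mul_neg, ← h.sum_normal_mul_stressAlong.self_of_nhds, Finset.mul_sum]
    rw [Finset.sum_comm]
    exact Finset.sum_congr rfl fun _ _ => Finset.sum_congr rfl fun _ _ => by ring
  have h3 : ∀ i, ∑ β, normalField G f (ψ y) β * ∑ κ, ∑ τ, christoffel G (ψ y) τ κ β *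
      tangentFrame ψ y i κ * stressAlong G γ f ψ y i τ =
      ∑ τ, stressAlong G γ f ψ y i τ * ∑ κ, ∑ β, christoffel G (ψ y) τ κ β *
      tangentFrame ψ y i κ * normalField G f (ψ y) β := by
    intro i
    simp only [Finset.mul_sum]
    rw [Finset.sum_comm]
    conv_lhs => enter [2, κ]; rw [Finset.sum_comm]
    rw [Finset.sum_comm]
    exact Finset.sum_congr rfl fun _ _ => Finset.sum_congr rfl fun _ _ =>
      Finset.sum_congr rfl fun _ _ => by ring
  -- Covariant Leibniz rule for ν^β T^i_β = -V^i: `h2` supplies the intrinsic connection of V, and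
  -- `h3` completes the derivative of ν in `h1` to a covariant one.
  have h4 : ∀ i, ∑ β, normalField G f (ψ y) β * R i β =
      - covDeriv (metricAlong G ψ) (energyVector G γ f ψ) y i i -
        ∑ τ, stressAlong G γ f ψ y i τ * ∑ κ, tangentFrame ψ y i κ *
          covDeriv G (fun w => normalField G f w) (ψ y) κ τ := by
    intro i
    simp only [← h.covDeriv_normal_along]
    simp only [hR, mul_sub, mul_add, Finset.sum_sub_distrib, Finset.sum_add_distrib, h1, h2, h3,
      covDeriv]
    ring
  rw [h0]
  simp only [h4, Finset.sum_sub_distrib, Finset.sum_neg_distrib, h.divergence_energyVector,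
    h.sum_stressAlong_mul_covDeriv]
  have h5 : γ (ψ y) (direction (G (ψ y)) (normalField G f (ψ y))) =
      gradientEnergy (G (ψ y)) (γ (ψ y)) (fun α' => pderiv f α' (ψ y)) := rfl
  simp only [diffusionTensor, add_mul, Finset.sum_add_distrib, h5, Finset.mul_sum, mul_assoc]
  ring

end IsLevelPatch

/-! ### Metric and energy in a chart -/

section Charts

set_option linter.unusedSectionVars false

variable {n : ℕ} {M : Type*} [TopologicalSpace M] [ChartedSpace (Coord n) M]
  [IsManifold 𝓘(ℝ, Coord n) ∞ M] {Z : OpenPartialHomeomorph M (Coord n)}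

theorem mdifferentiable_of_mem_maximalAtlas
    (hZ : Z ∈ IsManifold.maximalAtlas 𝓘(ℝ, Coord n) ∞ M) :
    Z.MDifferentiable 𝓘(ℝ, Coord n) 𝓘(ℝ, Coord n) :=
  ⟨fun _ hq => ((contMDiffAt_of_mem_maximalAtlas hZ hq).mdifferentiableAt
      (by simp)).mdifferentiableWithinAt,
    fun _ hz => ((contMDiffAt_symm_of_mem_maximalAtlas hZ hz).mdifferentiableAt
      (by simp)).mdifferentiableWithinAt⟩

theorem contMDiff_mk_tangentBundle : ContMDiff (𝓘(ℝ, Coord n).prod 𝓘(ℝ, Coord n))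
    (𝓘(ℝ, Coord n)).tangent ∞ (fun p : Coord n × Coord n =>
      (⟨p.1, p.2⟩ : TangentBundle 𝓘(ℝ, Coord n) (Coord n))) := by
  intro p
  apply Bundle.contMDiffAt_totalSpace.2
  refine ⟨contMDiffAt_fst, ?_⟩
  convert! (contMDiffAt_snd : ContMDiffAt (𝓘(ℝ, Coord n).prod 𝓘(ℝ, Coord n)) 𝓘(ℝ, Coord n) ∞
    (Prod.snd : Coord n × Coord n → Coord n) p) using 1
  ext q : 1
  simp

/-- On the target this is the tangent map of the smooth inverse chart, with the tangent bundle of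
the coordinate space identified with a product. -/
theorem contMDiffAt_ofCoord (hZ : Z ∈ IsManifold.maximalAtlas 𝓘(ℝ, Coord n) ∞ M)
    {z : Coord n} (hz : z ∈ Z.target) (X : Coord n) :
    ContMDiffAt 𝓘(ℝ, Coord n × Coord n) (𝓘(ℝ, Coord n)).tangent ∞
      (fun p : Coord n × Coord n =>
        (⟨Z.symm p.1, ofCoord Z p.1 p.2⟩ : TangentBundle 𝓘(ℝ, Coord n) M)) (z, X) := by
  have h1 := (contMDiffOn_symm_of_mem_maximalAtlas hZ).contMDiffOn_tangentMapWithin (m := ∞)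
    (by simp) Z.open_target.uniqueMDiffOn
  have h2 := (h1 ⟨z, X⟩ hz).contMDiffAt
    ((Z.open_target.preimage (FiberBundle.continuous_proj _ _)).mem_nhds hz)
  have h3 := ContMDiffAt.comp (z, X) h2 (contMDiff_mk_tangentBundle (n := n) (z, X))
  rw [modelWithCornersSelf_prod, ← chartedSpaceSelf_prod]
  refine h3.congr_of_eventuallyEq ?_
  filter_upwards [(Z.open_target.preimage continuous_fst).mem_nhds hz] with p hp
  simp [tangentMapWithin, ofCoord, mfderivWithin_of_isOpen Z.open_target hp]

theorem ofCoord_injective (hZ : Z ∈ IsManifold.maximalAtlas 𝓘(ℝ, Coord n) ∞ M)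
    {z : Coord n} (hz : z ∈ Z.target) : Function.Injective (ofCoord Z z) :=
  (mdifferentiable_of_mem_maximalAtlas hZ).symm.mfderiv_injective hz

theorem ofCoord_surjective (hZ : Z ∈ IsManifold.maximalAtlas 𝓘(ℝ, Coord n) ∞ M)
    {z : Coord n} (hz : z ∈ Z.target) : Function.Surjective (ofCoord Z z) :=
  (mdifferentiable_of_mem_maximalAtlas hZ).symm.mfderiv_surjective hz

theorem ofCoord_eq_sum (Z : OpenPartialHomeomorph M (Coord n)) (z X : Coord n) :
    ofCoord Z z X = ∑ α, X α • ofCoord Z z (coordVec α) := by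
  have hX : X = ∑ α, X α • (coordVec α : Coord n) := by
    ext β
    simp [coordVec, Pi.single_apply]
  conv_lhs => rw [hX]
  simp only [ofCoord]
  exact (map_sum (mfderiv 𝓘(ℝ, Coord n) 𝓘(ℝ, Coord n) Z.symm z) _ _).trans
    (Finset.sum_congr rfl fun α _ => map_smul _ _ _)

theorem ofCoord_smul (Z : OpenPartialHomeomorph M (Coord n)) (z : Coord n) (c : ℝ) (X : Coord n) :
    ofCoord Z z (c • X) = c • ofCoord Z z X :=
  map_smul (mfderiv 𝓘(ℝ, Coord n) 𝓘(ℝ, Coord n) Z.symm z) c X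

theorem ofCoord_ne_zero (hZ : Z ∈ IsManifold.maximalAtlas 𝓘(ℝ, Coord n) ∞ M)
    {z : Coord n} (hz : z ∈ Z.target) {X : Coord n} (hX : X ≠ 0) : ofCoord Z z X ≠ 0 :=
  fun h0 => hX (ofCoord_injective hZ hz (h0.trans
    (map_zero (mfderiv 𝓘(ℝ, Coord n) 𝓘(ℝ, Coord n) Z.symm z)).symm))

variable (m : RMetric n M)

theorem pairing_metricCoord (Z : OpenPartialHomeomorph M (Coord n)) (z X Y : Coord n) :
    pairing (metricCoord m Z z) X Y = m.inner (Z.symm z) (ofCoord Z z X) (ofCoord Z z Y) := by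
  rw [ofCoord_eq_sum Z z X, ofCoord_eq_sum Z z Y]
  simp only [pairing, metricCoord, Matrix.of_apply, map_sum, map_smul, sum_apply, smul_apply,
    smul_eq_mul, Finset.mul_sum]
  rw [Finset.sum_comm]
  exact Finset.sum_congr rfl fun _ _ => Finset.sum_congr rfl fun _ _ => by ring

theorem metricCoord_posDef (hZ : Z ∈ IsManifold.maximalAtlas 𝓘(ℝ, Coord n) ∞ M)
    {z : Coord n} (hz : z ∈ Z.target) : (metricCoord m Z z).PosDef := by
  refine Matrix.PosDef.of_dotProduct_mulVec_pos ?_ fun c hc => ?_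
  · ext α β
    simp [metricCoord, m.symm (Z.symm z) (ofCoord Z z (coordVec α))]
  · have h := pairing_eq_dotProduct (metricCoord m Z z) (WithLp.toLp 2 c) (WithLp.toLp 2 c)
    rw [pairing_metricCoord] at h
    rw [star_trivial, ← h]
    refine m.pos _ _ fun h0 => hc ?_
    by_contra hc0
    exact ofCoord_ne_zero hZ hz (by simpa using hc0) h0

theorem contDiffAt_metricCoord (hZ : Z ∈ IsManifold.maximalAtlas 𝓘(ℝ, Coord n) ∞ M)
    {z : Coord n} (hz : z ∈ Z.target) (α β : Fin n) :
    ContDiffAt ℝ ∞ (fun w => metricCoord m Z w α β) z := by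
  have hv : ∀ α : Fin n, ContMDiffAt 𝓘(ℝ, Coord n) (𝓘(ℝ, Coord n)).tangent ∞
      (fun w => (⟨Z.symm w, ofCoord Z w (coordVec α)⟩ : TangentBundle 𝓘(ℝ, Coord n) M)) z :=
    fun α => ContMDiffAt.comp (f := fun w : Coord n => (w, (coordVec α : Coord n))) z
      (contMDiffAt_ofCoord hZ hz (coordVec α))
      (contDiffAt_id.prodMk contDiffAt_const).contMDiffAt
  have hb : ContMDiffAt 𝓘(ℝ, Coord n) 𝓘(ℝ, Coord n) ∞ Z.symm z :=
    contMDiffAt_symm_of_mem_maximalAtlas hZ hz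
  have h : ContMDiffAt 𝓘(ℝ, Coord n) ((𝓘(ℝ, Coord n)).prod 𝓘(ℝ)) ∞
      (fun w => Bundle.TotalSpace.mk' ℝ (E := Bundle.Trivial M ℝ) (Z.symm w)
        (m.inner (Z.symm w) (ofCoord Z w (coordVec α)) (ofCoord Z w (coordVec β)))) z := by
    apply ContMDiffAt.clm_bundle_apply₂ (F₁ := Coord n) (F₂ := Coord n)
    · exact ContMDiffAt.comp z (m.contMDiff _) hb
    · exact hv α
    · exact hv β
  rw [Bundle.contMDiffAt_totalSpace] at h
  exact h.2.contDiffAt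

/-- Normalising in coordinates agrees with normalising by the Riemannian metric, so the function is
the normalised energy composed with the tangent map of the inverse chart. -/
theorem contDiffAt_energyCoord {γ : TangentBundle 𝓘(ℝ, Coord n) M → ℝ} (hγ : IsSmoothEnergy m γ)
    (hZ : Z ∈ IsManifold.maximalAtlas 𝓘(ℝ, Coord n) ∞ M)
    {z : Coord n} (hz : z ∈ Z.target) {X : Coord n} (hX : X ≠ 0) :
    ContDiffAt ℝ ∞ (fun p : Coord n × Coord n =>
      energyCoord γ Z p.1 (direction (metricCoord m Z p.1) p.2)) (z, X) := by
  have h1 := ContMDiffWithinAt.comp (z, X) (s := Z.target ×ˢ {0}ᶜ)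
    (hγ ⟨Z.symm z, ofCoord Z z X⟩ (ofCoord_ne_zero hZ hz hX))
    (contMDiffAt_ofCoord hZ hz X).contMDiffWithinAt
    fun p hp => ofCoord_ne_zero hZ hp.1 hp.2
  have h2 := h1.contMDiffAt ((Z.open_target.prod isOpen_compl_singleton).mem_nhds ⟨hz, hX⟩)
  refine h2.contDiffAt.congr_of_eventuallyEq (Eventually.of_forall fun p => ?_)
  simp only [energyCoord, direction, ofCoord_smul, pairing_metricCoord, Function.comp_def]

end Charts

/-! ### Functions and their gradients in a chart -/

section Functions

set_option linter.unusedSectionVars false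

variable {n : ℕ} {M : Type*} [TopologicalSpace M] [ChartedSpace (Coord n) M]
  [IsManifold 𝓘(ℝ, Coord n) ∞ M] {Z : OpenPartialHomeomorph M (Coord n)} {f : M → ℝ}

theorem contDiffAt_comp_chart_symm (hZ : Z ∈ IsManifold.maximalAtlas 𝓘(ℝ, Coord n) ∞ M)
    {z : Coord n} (hz : z ∈ Z.target) (hf : ContMDiffAt 𝓘(ℝ, Coord n) 𝓘(ℝ, ℝ) ∞ f (Z.symm z)) :
    ContDiffAt ℝ ∞ (f ∘ Z.symm) z :=
  (ContMDiffAt.comp z hf (contMDiffAt_symm_of_mem_maximalAtlas hZ hz)).contDiffAt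

theorem directional_ofCoord (hZ : Z ∈ IsManifold.maximalAtlas 𝓘(ℝ, Coord n) ∞ M)
    {z : Coord n} (hz : z ∈ Z.target)
    (hf : MDifferentiableAt 𝓘(ℝ, Coord n) 𝓘(ℝ, ℝ) f (Z.symm z)) (X : Coord n) :
    directional f (Z.symm z) (ofCoord Z z X) = ∑ α, X α * pderiv (f ∘ Z.symm) α z := by
  rw [← fderiv_eq_sum_pderiv, ← mfderiv_eq_fderiv,
    mfderiv_comp z hf ((contMDiffAt_symm_of_mem_maximalAtlas hZ hz).mdifferentiableAt (by simp))]
  rfl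

theorem ofCoord_component (hZ : Z ∈ IsManifold.maximalAtlas 𝓘(ℝ, Coord n) ∞ M)
    {z : Coord n} (hz : z ∈ Z.target) (v : TangentSpace 𝓘(ℝ, Coord n) (Z.symm z)) :
    ofCoord Z z (WithLp.toLp 2 (component Z (Z.symm z) v)) = v := by
  obtain ⟨X, rfl⟩ := ofCoord_surjective hZ hz v
  have h := congrArg (fun L => L X) ((mdifferentiable_of_mem_maximalAtlas hZ).comp_symm_deriv hz)
  congr 1

theorem directional_eq_sum (hZ : Z ∈ IsManifold.maximalAtlas 𝓘(ℝ, Coord n) ∞ M)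
    {q : M} (hq : q ∈ Z.source) (hf : MDifferentiableAt 𝓘(ℝ, Coord n) 𝓘(ℝ, ℝ) f q)
    (v : TangentSpace 𝓘(ℝ, Coord n) q) :
    directional f q v = ∑ α, component Z q v α * pderiv (f ∘ Z.symm) α (Z q) := by
  obtain ⟨z, hz, rfl⟩ : ∃ z ∈ Z.target, Z.symm z = q := ⟨Z q, Z.map_source hq, Z.left_inv hq⟩
  rw [Z.right_inv hz, ← directional_ofCoord hZ hz hf (WithLp.toLp 2 (component Z (Z.symm z) v)),
    ofCoord_component hZ hz]

/-- The vector representing the differential through the metric has the raised partial derivatives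
as its coordinates. -/
theorem sum_pderiv_mul_raiseIndex (m : RMetric n M)
    (hZ : Z ∈ IsManifold.maximalAtlas 𝓘(ℝ, Coord n) ∞ M)
    {z : Coord n} (hz : z ∈ Z.target) (hf : MDifferentiableAt 𝓘(ℝ, Coord n) 𝓘(ℝ, ℝ) f (Z.symm z))
    (hu : HasUnitGradientAt m f (Z.symm z)) :
    ∑ α, pderiv (f ∘ Z.symm) α z *
      raiseIndex (metricCoord m Z z) (fun α => pderiv (f ∘ Z.symm) α z) α = 1 := by
  obtain ⟨N, hN, hN1⟩ := hu
  obtain ⟨X, rfl⟩ := ofCoord_surjective hZ hz N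
  have hdet : IsUnit (metricCoord m Z z).det := (metricCoord_posDef m hZ hz).det_pos.ne'.isUnit
  have h : ∀ Y, pairing (metricCoord m Z z) Y X = ∑ α, pderiv (f ∘ Z.symm) α z * Y α := by
    intro Y
    rw [pairing_metricCoord, m.symm, hN, directional_ofCoord hZ hz hf]
    exact Finset.sum_congr rfl fun _ _ => mul_comm _ _
  have hX : (metricCoord m Z z) *ᵥ X.ofLp = fun α => pderiv (f ∘ Z.symm) α z := by
    ext α
    have := h (coordVec α)
    rw [pairing_eq_dotProduct] at this
    simpa [coordVec, Pi.single_apply] using this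
  have hr : raiseIndex (metricCoord m Z z) (fun α => pderiv (f ∘ Z.symm) α z) = X := by
    rw [raiseIndex, ← hX, Matrix.mulVec_mulVec, Matrix.nonsing_inv_mul _ hdet, Matrix.one_mulVec]
  rw [hr, ← h, pairing_metricCoord, hN1]

end Functions

/-! ### Injectivity of the differential of an immersion -/

section Immersions

variable {k n : ℕ} {S : Type*} [TopologicalSpace S] [ChartedSpace (Coord k) S]
  [IsManifold 𝓘(ℝ, Coord k) ∞ S] {M : Type*} [TopologicalSpace M] [ChartedSpace (Coord n) M]
  [IsManifold 𝓘(ℝ, Coord n) ∞ M]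

/-- In the adapted charts the map is an injective linear map, and the differential of the domain
chart is injective. -/
theorem mfderiv_injective_of_isImmersionAt {f : S → M} {p : S}
    (hf : Manifold.IsImmersionAt 𝓘(ℝ, Coord k) 𝓘(ℝ, Coord n) ∞ f p) :
    Function.Injective (mfderiv 𝓘(ℝ, Coord k) 𝓘(ℝ, Coord n) f p) := by
  have hdom := mdifferentiable_of_mem_maximalAtlas hf.domChart_mem_maximalAtlas
  have hcod := mdifferentiable_of_mem_maximalAtlas hf.codChart_mem_maximalAtlas
  have hp := hf.mem_domChart_source
  have hfp := hf.mem_codChart_source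
  have heq : hf.codChart ∘ f =ᶠ[𝓝 p]
      ((hf.equiv : (Coord k × hf.complement) →L[ℝ] Coord n) ∘L
        ContinuousLinearMap.inl ℝ (Coord k) hf.complement) ∘ hf.domChart := by
    filter_upwards [hf.domChart.open_source.mem_nhds hp] with x hx
    have := hf.writtenInCharts (show hf.domChart x ∈ (hf.domChart.extend 𝓘(ℝ, Coord k)).target by
      simpa using hf.domChart.map_source hx)
    simpa [hf.domChart.left_inv hx] using this
  have hfd : MDifferentiableAt 𝓘(ℝ, Coord k) 𝓘(ℝ, Coord n) f p :=
    hf.contMDiffAt.mdifferentiableAt (by simp)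
  have h1 := mfderiv_comp p (hcod.mdifferentiableAt hfp) hfd
  have hL : MDifferentiableAt 𝓘(ℝ, Coord k) 𝓘(ℝ, Coord n)
    ((hf.equiv : (Coord k × hf.complement) →L[ℝ] Coord n) ∘L
        ContinuousLinearMap.inl ℝ (Coord k) hf.complement) (hf.domChart p) :=
    ContinuousLinearMap.mdifferentiableAt _
  have h2 := mfderiv_comp p hL (hdom.mdifferentiableAt hp)
  rw [heq.mfderiv_eq, h2, ContinuousLinearMap.mfderiv_eq] at h1
  have hinj : Function.Injective (mfderiv 𝓘(ℝ, Coord n) 𝓘(ℝ, Coord n) hf.codChart (f p) ∘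
      mfderiv 𝓘(ℝ, Coord k) 𝓘(ℝ, Coord n) f p) := by
    have hLinj : Function.Injective ((hf.equiv : (Coord k × hf.complement) →L[ℝ] Coord n) ∘L
        ContinuousLinearMap.inl ℝ (Coord k) hf.complement) :=
      hf.equiv.injective.comp (Prod.mk_left_injective 0)
    rw [← ContinuousLinearMap.coe_comp, ← h1]
    exact hLinj.comp (hdom.mfderiv_injective hp)
  exact hinj.of_comp

end Immersions

/-! ### From the manifold to level patches -/

section Patches

set_option linter.unusedSectionVars false

variable {s : ℕ} {M : Type*} [TopologicalSpace M] [ChartedSpace (Coord (s + 1)) M]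
  [IsManifold 𝓘(ℝ, Coord (s + 1)) ∞ M] {m : RMetric (s + 1) M}
  {γ : TangentBundle 𝓘(ℝ, Coord (s + 1)) M → ℝ} {f : M → ℝ} {κ : Coord s → M} {y : Coord s}
  {Z : OpenPartialHomeomorph M (Coord (s + 1))}

theorem isLevelPatch_chart (hγ : IsSmoothEnergy m γ) (hγ' : DependsOnInclinationOnly m γ)
    (hZ : Z ∈ IsManifold.maximalAtlas 𝓘(ℝ, Coord (s + 1)) ∞ M) (hy : κ y ∈ Z.source)
    (hf : ∀ᶠ q in 𝓝 (κ y), ContMDiffAt 𝓘(ℝ, Coord (s + 1)) 𝓘(ℝ, ℝ) ∞ f q)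
    (hu : ∀ᶠ q in 𝓝 (κ y), HasUnitGradientAt m f q)
    (hκ : ContMDiffAt 𝓘(ℝ, Coord s) 𝓘(ℝ, Coord (s + 1)) ∞ κ y)
    (hκ' : Function.Injective (mfderiv 𝓘(ℝ, Coord s) 𝓘(ℝ, Coord (s + 1)) κ y))
    (hl : ∀ᶠ x in 𝓝 y, f (κ x) = f (κ y)) :
    IsLevelPatch (metricCoord m Z) (energyCoord γ Z) (f ∘ Z.symm) (Z ∘ κ) y := by
  have hz : Z (κ y) ∈ Z.target := Z.map_source hy
  have htarget := Z.open_target.mem_nhds hz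
  have hsymm : Tendsto Z.symm (𝓝 (Z (κ y))) (𝓝 (κ y)) := by
    have := Z.symm.continuousAt hz
    rwa [ContinuousAt, Z.left_inv hy] at this
  have hsource := hκ.continuousAt.eventually (Z.open_source.mem_nhds hy)
  have hcomp : ContMDiffAt 𝓘(ℝ, Coord s) 𝓘(ℝ, Coord (s + 1)) ∞ (Z ∘ κ) y :=
    ContMDiffAt.comp y (contMDiffAt_of_mem_maximalAtlas hZ hy) hκ
  have hZd := mdifferentiable_of_mem_maximalAtlas hZ
  exact {
    metric := contDiffAt_metricCoord m hZ hz
    posDef := by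
      filter_upwards [htarget] with w hw using metricCoord_posDef m hZ hw
    energy := fun X hX => contDiffAt_energyCoord m hγ hZ hz hX
    horizontal := fun X hX α => hγ' Z hZ _ hz X hX α
    levelFun := contDiffAt_comp_chart_symm hZ hz (by
      rw [Function.comp_apply, Z.left_inv hy]
      exact hf.self_of_nhds)
    unit := by
      filter_upwards [htarget, hsymm.eventually hf, hsymm.eventually hu] with w hw h1 h2
      exact sum_pderiv_mul_raiseIndex m hZ hw (h1.mdifferentiableAt (by simp)) h2
    param := hcomp.contDiffAt
    immersive := by
      rw [← mfderiv_eq_fderiv, mfderiv_comp y (hZd.mdifferentiableAt hy)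
        (hκ.mdifferentiableAt (by simp))]
      exact (hZd.mfderiv_injective hy).comp hκ'
    level := by
      filter_upwards [hl, hsource] with x hx hx'
      simpa [Z.left_inv hx', Z.left_inv hy] using hx }

/-- The normal component of the driving vector, in a chart of the ambient manifold. -/
theorem sum_drivingVector_mul_pderiv
    (h : IsLevelPatch (metricCoord m Z) (energyCoord γ Z) (f ∘ Z.symm) (Z ∘ κ) y) :
    ∑ α, drivingVector m γ f κ y Z α * pderiv (f ∘ Z.symm) α (Z (κ y)) =
      -anisotropicLaplacian m γ f Z (κ y) :=
  h.sum_drivingCoord_mul_pderiv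

/-- The transport term is linear in the velocity, so it equals μ times the normal component of A,
and the two equations have the same left-hand side. -/
theorem transportEq_iff_diffusionEq {φ : ℝ → M → ℝ} {t μ : ℝ} {q : M} (hy : κ y = q)
    (hq : q ∈ Z.source) (hZ : Z ∈ IsManifold.maximalAtlas 𝓘(ℝ, Coord (s + 1)) ∞ M)
    (hf : MDifferentiableAt 𝓘(ℝ, Coord (s + 1)) 𝓘(ℝ, ℝ) (φ t) q)
    (h : IsLevelPatch (metricCoord m Z) (energyCoord γ Z) (φ t ∘ Z.symm) (Z ∘ κ) y)
    (v : TangentSpace 𝓘(ℝ, Coord (s + 1)) q)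
    (hv : ∀ α, component Z q v α = μ * drivingVector m γ (φ t) κ y Z α) :
    TransportEq φ t q v ↔ DiffusionEq m γ μ φ t q Z := by
  have hA := sum_drivingVector_mul_pderiv h
  rw [hy] at hA
  rw [TransportEq, DiffusionEq, directional_eq_sum hZ hq hf]
  simp only [hv, mul_assoc, ← Finset.mul_sum, hA, mul_neg, ← sub_eq_add_neg]

/-- A slice of `W` at fixed time is open in `M`, so smoothness within the closed time interval gives
genuine spatial smoothness, even at times 0 and 1. -/
theorem contMDiffAt_slice {φ : ℝ → M → ℝ} {W : Set (ℝ × M)} (hW : IsOpen W)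
    (hφ : ContMDiffOn (𝓘(ℝ, ℝ).prod 𝓘(ℝ, Coord (s + 1))) 𝓘(ℝ, ℝ) ∞
      (fun w : ℝ × M => φ w.1 w.2) (W ∩ Icc (0 : ℝ) 1 ×ˢ univ))
    {t : ℝ} (ht : t ∈ Icc (0 : ℝ) 1) {q : M} (hq : (t, q) ∈ W) :
    ContMDiffAt 𝓘(ℝ, Coord (s + 1)) 𝓘(ℝ, ℝ) ∞ (φ t) q := by
  have h := ContMDiffOn.comp (f := fun q : M => (t, q)) (s := {q | (t, q) ∈ W}) hφ
    (contMDiff_const.prodMk contMDiff_id).contMDiffOn fun q hq => ⟨hq, ht, mem_univ _⟩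
  exact h.contMDiffAt ((hW.preimage (Continuous.prodMk_right t)).mem_nhds hq)

end Patches

end LevelSetFlow

end

theorem mainTheorem3 {s : ℕ}
    {M : Type*} [TopologicalSpace M] [ChartedSpace (LevelSetFlow.Coord (s + 1)) M]
    [IsManifold 𝓘(ℝ, LevelSetFlow.Coord (s + 1)) ∞ M]
    (m : LevelSetFlow.RMetric (s + 1) M)
    {S : Type*} [TopologicalSpace S] [ChartedSpace (LevelSetFlow.Coord s) S]
    [IsManifold 𝓘(ℝ, LevelSetFlow.Coord s) ∞ S]
    (γ : TangentBundle 𝓘(ℝ, LevelSetFlow.Coord (s + 1)) M → ℝ)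
    (hγ : LevelSetFlow.IsSmoothEnergy m γ)
    (hγ' : LevelSetFlow.DependsOnInclinationOnly m γ)
    (μ : ℝ)
    (ψ : ℝ → S → M)
    (hψ : ∀ t ∈ Icc (0 : ℝ) 1,
      Manifold.IsSmoothEmbedding 𝓘(ℝ, LevelSetFlow.Coord s) 𝓘(ℝ, LevelSetFlow.Coord (s + 1)) ∞
        (ψ t))
    (φ : ℝ → M → ℝ) (W : Set (ℝ × M)) (hW : IsOpen W)
    (hψW : ∀ t ∈ Icc (0 : ℝ) 1, ∀ p, (t, ψ t p) ∈ W)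
    (hφ : ContMDiffOn (𝓘(ℝ, ℝ).prod 𝓘(ℝ, LevelSetFlow.Coord (s + 1))) 𝓘(ℝ, ℝ) ∞
      (fun w : ℝ × M => φ w.1 w.2) (W ∩ Icc (0 : ℝ) 1 ×ˢ univ))
    (hφψ : ∀ t ∈ Icc (0 : ℝ) 1, ∀ p, φ t (ψ t p) = 0)
    (hφd : ∀ t ∈ Icc (0 : ℝ) 1, ∀ q, (t, q) ∈ W → LevelSetFlow.HasUnitGradientAt m (φ t) q) :
    -- on the interface
    (∀ t ∈ Icc (0 : ℝ) 1, ∀ p : S,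
      ∀ x ∈ IsManifold.maximalAtlas 𝓘(ℝ, LevelSetFlow.Coord s) ∞ S, p ∈ x.source →
      ∀ Z ∈ IsManifold.maximalAtlas 𝓘(ℝ, LevelSetFlow.Coord (s + 1)) ∞ M, ψ t p ∈ Z.source →
        (∑ α, LevelSetFlow.drivingVector m γ (φ t) (ψ t ∘ x.symm) (x p) Z α *
            LevelSetFlow.pderiv (φ t ∘ Z.symm) α (Z (ψ t p))
          = -LevelSetFlow.anisotropicLaplacian m γ (φ t) Z (ψ t p)) ∧
        (∀ v : TangentSpace 𝓘(ℝ, LevelSetFlow.Coord (s + 1)) (ψ t p),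
          (∀ α, LevelSetFlow.component Z (ψ t p) v α =
            μ * LevelSetFlow.drivingVector m γ (φ t) (ψ t ∘ x.symm) (x p) Z α) →
          (LevelSetFlow.TransportEq φ t (ψ t p) v ↔
            LevelSetFlow.DiffusionEq m γ μ φ t (ψ t p) Z))) ∧
    -- off the interface, for the field `A` extended by means of the other level sets
    (∀ t ∈ Icc (0 : ℝ) 1, ∀ q : M, (t, q) ∈ W →
      ∀ (κ : LevelSetFlow.Coord s → M) (y : LevelSetFlow.Coord s),
      Manifold.IsImmersionAt 𝓘(ℝ, LevelSetFlow.Coord s) 𝓘(ℝ, LevelSetFlow.Coord (s + 1)) ∞ κ y →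
      κ y = q → (∀ᶠ y' in 𝓝 y, φ t (κ y') = φ t q) →
      ∀ Z ∈ IsManifold.maximalAtlas 𝓘(ℝ, LevelSetFlow.Coord (s + 1)) ∞ M, q ∈ Z.source →
      ∀ v : TangentSpace 𝓘(ℝ, LevelSetFlow.Coord (s + 1)) q,
        (∀ α, LevelSetFlow.component Z q v α =
          μ * LevelSetFlow.drivingVector m γ (φ t) κ y Z α) →
        (LevelSetFlow.TransportEq φ t q v ↔ LevelSetFlow.DiffusionEq m γ μ φ t q Z)) := by
  constructor
  · intro t ht p x hx hp Z hZ hZp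
    have hev : ∀ᶠ q in 𝓝 (ψ t p), (t, q) ∈ W :=
      (hW.preimage (Continuous.prodMk_right t)).mem_nhds (hψW t ht p)
    have hxp : (ψ t ∘ x.symm) (x p) = ψ t p := by simp [x.left_inv hp]
    have hxd := (LevelSetFlow.mdifferentiable_of_mem_maximalAtlas hx).symm
    have himm := (hψ t ht).isImmersion.isImmersionAt (x.symm (x p))
    have hx' : ContMDiffAt 𝓘(ℝ, LevelSetFlow.Coord s) 𝓘(ℝ, LevelSetFlow.Coord s) ∞ x.symm (x p) :=
      contMDiffAt_symm_of_mem_maximalAtlas hx (x.map_source hp)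
    have hψp : ContMDiffAt 𝓘(ℝ, LevelSetFlow.Coord s) 𝓘(ℝ, LevelSetFlow.Coord (s + 1)) ∞ (ψ t)
        (x.symm (x p)) := (hψ t ht).contMDiff _
    have hpatch := LevelSetFlow.isLevelPatch_chart (κ := ψ t ∘ x.symm) (y := x p) (f := φ t)
      hγ hγ' hZ (by rwa [hxp])
      (by rw [hxp]; exact hev.mono fun q hq => LevelSetFlow.contMDiffAt_slice hW hφ ht hq)
      (by rw [hxp]; exact hev.mono fun q hq => hφd t ht q hq)
      (ContMDiffAt.comp (x p) hψp hx')
      (by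
        rw [mfderiv_comp (x p) (hψp.mdifferentiableAt (by simp)) (hx'.mdifferentiableAt (by simp))]
        exact (LevelSetFlow.mfderiv_injective_of_isImmersionAt himm).comp
          (hxd.mfderiv_injective (x.map_source hp)))
      -- Every value of `ψ t` lies on the zero level set, so the level condition holds even at
      -- parameters outside the target of the chart `x`.
      (Eventually.of_forall fun x' => by simp [hφψ t ht])
    refine ⟨?_, fun v hv => LevelSetFlow.transportEq_iff_diffusionEq hxp hZp hZ
      ((LevelSetFlow.contMDiffAt_slice hW hφ ht (hψW t ht p)).mdifferentiableAt (by simp))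
      hpatch v hv⟩
    have := LevelSetFlow.sum_drivingVector_mul_pderiv hpatch
    rwa [hxp] at this
  · rintro t ht q hq κ y hκ rfl hl Z hZ hZq v hv
    have hev : ∀ᶠ q in 𝓝 (κ y), (t, q) ∈ W :=
      (hW.preimage (Continuous.prodMk_right t)).mem_nhds hq
    exact LevelSetFlow.transportEq_iff_diffusionEq rfl hZq hZ
      ((LevelSetFlow.contMDiffAt_slice hW hφ ht hq).mdifferentiableAt (by simp))
      (LevelSetFlow.isLevelPatch_chart hγ hγ' hZ hZq
        (hev.mono fun q hq => LevelSetFlow.contMDiffAt_slice hW hφ ht hq)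
        (hev.mono fun q hq => hφd t ht q hq) hκ.contMDiffAt
        (LevelSetFlow.mfderiv_injective_of_isImmersionAt hκ) hl) v hv
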